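/- Let $\mathbb H$ be the upper half plane and $q=e^{2\pi i\tau}$ for $\tau\in\mathbb H$. For an odd Dirichlet character $\chi$ modulo $7$ put $$E_{1,\chi}(\tau)=1+\frac{2}{L(0,\chi)}\sum_{n\ge 1}\chi(n)\frac{q^n}{1-q^n},\qquad \mathcal E_7(\tau)=\frac13\sum_{\chi}E_{1,\chi}(\tau),$$ where $L(s,\chi)$ is the analytically continued $L$-function and the sum in $\mathcal E_7$ runs over the odd primitive Dirichlet characters modulo $7$. For $\gamma=\begin{pmatrix}\alpha&\beta\\ c&d\end{pmatrix}\in\Gamma_0(7)\subset SL_2(\mathbb Z)$ let $\langle\gamma\rangle(\mathcal E_7)(\tau)=(c\tau+d)^{-1}\mathcal E_7(\gamma\tau)$, and for $a\in(\mathbb Z/7\mathbb Z)^*$ let $\mathcal E_{a,7}=\langle\gamma\rangle(\mathcal E_7)$ for any $\gamma\in\Gamma_0(7)$ with lower right entry $d\equiv a\pmod 7$. Let $\eta$ be the Dedekind eta function and, for $l=1,2,3$, let $$\phi_{7,l}(\tau)=e^{-(2l-1)\pi i/14}\sum_{n\in\mathbb Z}\exp 2\pi i\Bigl\{\tfrac12\bigl(n+\tfrac{2l-1}{14}\bigr)^2\,7\tau+\tfrac12\bigl(n+\tfrac{2l-1}{14}\bigr)\Bigr\}.$$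 Theorem. (1) Whatever $\gamma$'s are used to form them, the level-7 generators satisfy, for all $\tau\in\mathbb H$, $$\mathcal E_{2,7}\mathcal E_{4,7}+\mathcal E_{2,7}\mathcal E_{1,7}+\mathcal E_{4,7}\mathcal E_{1,7}=0,$$ and they have the theta quotient representations $$\mathcal E_{1,7}=\eta(7\tau)^3\frac{\phi_{7,1}}{\phi_{7,3}^2},\qquad \mathcal E_{2,7}=\eta(7\tau)^3\frac{\phi_{7,2}}{\phi_{7,1}^2},\qquad \mathcal E_{4,7}=-\eta(7\tau)^3\frac{\phi_{7,3}}{\phi_{7,2}^2}.$$ (2) This gives a theta-constant parameterization of the Klein quartic: the functions $\phi_{7,1},\phi_{7,2},\phi_{7,3}$ are holomorphic and have no zeros on $\mathbb H$, and with $a=\phi_{7,2}$, $b=\phi_{7,1}$, $c=-\phi_{7,3}$ the map $\tau\mapsto[a(\tau):b(\tau):c(\tau)]$ is a non-constant map from $\mathbb H$ into the curve $\{[a:b:c]\in\mathbb C\mathbb P^2 : a^3b+b^3c+c^3a=0\}$. -/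

import Mathlib

open UpperHalfPlane CongruenceSubgroup
open scoped ModularForm MatrixGroups LinearAlgebra.Projectivization

noncomputable section

namespace KleinTheta

/-- The Hecke Eisenstein series of weight `k ≥ 1` twisted by a Dirichlet character `χ`,
`E_{k,χ}(τ) = 1 + 2 / L(1 - k, χ) * ∑_{n ≥ 1} χ(n) n^(k-1) q^n / (1 - q^n)`, `q = exp(2πiτ)`. -/
def eisenstein {N : ℕ} [NeZero N] (k : ℕ) (χ : DirichletCharacter ℂ N) (τ : ℍ) : ℂ :=
  1 + 2 / χ.LFunction (1 - k) *
    ∑' n : ℕ+, χ ((n : ℕ) : ZMod N) *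
      (((n : ℕ) : ℂ) ^ (k - 1) * Complex.exp (2 * Real.pi * Complex.I * τ) ^ (n : ℕ) /
        (1 - Complex.exp (2 * Real.pi * Complex.I * τ) ^ (n : ℕ)))

/-- `2 / (p - 1)` times the sum of the weight one series `E_{1,χ}` over the odd primitive Dirichlet
characters modulo `p`. -/
def eisensteinSum (p : ℕ) [NeZero p] (τ : ℍ) : ℂ :=
  2 / ((p : ℂ) - 1) *
    ∑ᶠ (χ : DirichletCharacter ℂ p) (_ : χ.Odd ∧ χ.IsPrimitive), eisenstein 1 χ τ

/-- The diamond operator of `γ ∈ Γ₀(N)` in weight `k`. -/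
def diamond {N : ℕ} (k : ℤ) (γ : Gamma0 N) (f : ℍ → ℂ) : ℍ → ℂ :=
  f ∣[k] (γ : SL(2, ℤ))

theorem diamond_apply {N : ℕ} (k : ℤ) (γ : Gamma0 N) (f : ℍ → ℂ) (τ : ℍ) :
    diamond k γ f τ =
      (((γ : SL(2, ℤ)) 1 0 : ℂ) * τ + ((γ : SL(2, ℤ)) 1 1 : ℂ)) ^ (-k) *
        f ((γ : SL(2, ℤ)) • τ) := by
  rw [diamond, ModularForm.SL_slash_apply, mul_comm]
  simp [UpperHalfPlane.denom]

/-- The theta function with real characteristic `[ε, ε']`. -/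
def thetaChar (ε ε' : ℝ) (z τ : ℂ) : ℂ :=
  ∑' n : ℤ, Complex.exp (2 * Real.pi * Complex.I *
    (1 / 2 * ((n : ℂ) + ε / 2) ^ 2 * τ + ((n : ℂ) + ε / 2) * (z + ε' / 2)))

/-- The theta constant `φ_{k,l}(τ) = θ[(2l-1)/k, 1](0, kτ)` of order `k` and index `l`. -/
def thetaConst (k l : ℕ) (τ : ℂ) : ℂ :=
  thetaChar ((2 * (l : ℝ) - 1) / k) 1 0 (k * τ)

/-- The theta constant of order `k` and index `l`, normalized so that its leading coefficient as a
series in fractional powers of `q` is one. -/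
def normThetaConst (k l : ℕ) (τ : ℂ) : ℂ :=
  Complex.exp (-((2 * (l : ℂ) - 1) * Real.pi * Complex.I / (2 * k))) * thetaConst k l τ

/-- The quartic form `a³b + b³c + c³a`. -/
def kleinForm (v : Fin 3 → ℂ) : ℂ :=
  v 0 ^ 3 * v 1 + v 1 ^ 3 * v 2 + v 2 ^ 3 * v 0

theorem kleinForm_smul (t : ℂ) (v : Fin 3 → ℂ) : kleinForm (t • v) = t ^ 4 * kleinForm v := by
  simp only [kleinForm, Pi.smul_apply, smul_eq_mul]
  ring

/-- The Klein quartic in the complex projective plane. -/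
def kleinQuartic : Set (ℙ ℂ (Fin 3 → ℂ)) := {P | kleinForm P.rep = 0}

theorem mk_mem_kleinQuartic (v : Fin 3 → ℂ) (hv : v ≠ 0) :
    Projectivization.mk ℂ v hv ∈ kleinQuartic ↔ kleinForm v = 0 := by
  obtain ⟨t, ht⟩ := Projectivization.exists_smul_eq_mk_rep ℂ v hv
  have h : kleinForm (Projectivization.mk ℂ v hv).rep = (t : ℂ) ^ 4 * kleinForm v := by
    rw [← ht, ← kleinForm_smul]
    rfl
  change kleinForm (Projectivization.mk ℂ v hv).rep = 0 ↔ _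
  rw [h]
  simp

/-- The vector of theta constants `(φ_{7,2}, φ_{7,1}, -φ_{7,3})`, normalized. -/
def thetaVector (τ : ℍ) : Fin 3 → ℂ :=
  ![normThetaConst 7 2 τ, normThetaConst 7 1 τ, -normThetaConst 7 3 τ]

end KleinTheta

end

open UpperHalfPlane CongruenceSubgroup
open scoped ModularForm MatrixGroups LinearAlgebra.Projectivization

noncomputable section

namespace KleinTheta

open Filter Topology

/-! Everything is expressed through one odd theta function θ(z) = `oddTheta z σ` with σ = 7τ,
evaluated at multiples of τ. The Jacobi triple product (`oddTheta_eq_prod`) locates its zeros, gives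
θ'(0) = 2πi∏(1-p^n)^3 with p = exp(2πiσ), hence the factor η(7τ)^3, and turns θ'/θ at aτ into
Lambert series over the residue classes ±a mod 7.

On the Eisenstein side, Abel summation evaluates L(0,χ) (`LFunction_zero_eq`). For odd χ mod 7,
2/L(0,χ) is the linear combination 2χ(1)+χ(4)+χ(5), so orthogonality of characters collapses the
average over χ to 1 + ∑ c(n) q^n/(1-q^n), where c is odd with values 2, 1, 1 at 1, 2, 3. Up to the
factor -2πi this is 2(θ'/θ)(τ) + (θ'/θ)(2τ) - (θ'/θ)(4τ). Differentiating Weierstrass's three-term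
relation shows that this combination is the single quotient θ'(0)θ(3u)²/(θ(u)²θ(4u)) at u = τ
(`logDeriv_add_eq_thetaQuot`).

That quotient is elliptic in u and transforms with weight one under SL(2,ℤ), so a diamond operator
with lower right entry d merely replaces u = τ by u = d⁻¹τ (`diamond_eisensteinSum`). Since φ_{7,l}
is, up to an exponential factor, θ((l-4)τ), the three quotients at τ, 4τ, 2τ become the stated theta
quotients.

The quartic is the same three-term relation at (3τ, 2τ, τ, 0), after reducing 4τ and 5τ modulo 7τ
(`kleinForm_thetaVector`). The quadratic relation between the Eisenstein series is this quartic
divided by (φ₁φ₂φ₃)² and multiplied by η(7τ)^6. Non-constancy follows by comparing how two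
coordinates change under τ ↦ τ + 1. -/

/-! ### The Jacobi triple product -/

/-- The finite product `(1 - p) ⋯ (1 - p ^ n)`. -/
def eulerPartial (p : ℂ) (n : ℕ) : ℂ := ∏ j ∈ Finset.range n, (1 - p ^ (j + 1))

/-- The product `∏ (1 - p ^ n x)` over `n ≥ 1`. -/
def eulerProd (p x : ℂ) : ℂ := ∏' n : ℕ, (1 - p ^ (n + 1) * x)

/-- The reciprocal of `(1 - p) ⋯ (1 - p ^ m)`, extended by zero to negative `m`. -/
def invEuler (p : ℂ) (m : ℤ) : ℂ := if m < 0 then 0 else (eulerPartial p m.toNat)⁻¹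

theorem one_sub_pow_ne_zero {p : ℂ} (hp : ‖p‖ < 1) (n : ℕ) : 1 - p ^ (n + 1) ≠ 0 := by
  intro h
  have h1 : ‖p ^ (n + 1)‖ < 1 := by
    rw [norm_pow]
    exact pow_lt_one₀ (norm_nonneg _) hp (Nat.succ_ne_zero n)
  rw [← sub_eq_zero.mp h] at h1
  simp at h1

theorem eulerPartial_succ (p : ℂ) (n : ℕ) :
    eulerPartial p (n + 1) = eulerPartial p n * (1 - p ^ (n + 1)) :=
  Finset.prod_range_succ _ _

theorem eulerPartial_ne_zero {p : ℂ} (hp : ‖p‖ < 1) (n : ℕ) : eulerPartial p n ≠ 0 :=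
  Finset.prod_ne_zero_iff.mpr fun j _ ↦ one_sub_pow_ne_zero hp j

/-- The extension by zero is chosen so that this recursion needs no sign condition: at m = 0 the
factor 1 - p^0 vanishes. -/
theorem invEuler_sub_one {p : ℂ} (hp : ‖p‖ < 1) (m : ℤ) :
    invEuler p (m - 1) = (1 - p ^ m) * invEuler p m := by
  rcases lt_trichotomy m 0 with h | rfl | h
  · simp [invEuler, h, show m < 1 by omega]
  · simp [invEuler]
  · obtain ⟨n, rfl⟩ : ∃ n : ℕ, m = n + 1 := ⟨(m - 1).toNat, by omega⟩
    have h1 : (n + 1 : ℤ).toNat = n + 1 := by omega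
    have h2 : ¬ ((n : ℤ) + 1 < 0) := by omega
    have h3 := eulerPartial_ne_zero hp n
    have h4 := one_sub_pow_ne_zero hp n
    simp only [invEuler, add_sub_cancel_right, h1, h2, if_false, Int.toNat_natCast,
      eulerPartial_succ]
    rw [if_neg (by omega), show p ^ ((n : ℤ) + 1) = p ^ (n + 1) from mod_cast zpow_natCast p (n + 1)]
    field_simp

theorem summable_pow_succ_mul {p : ℂ} (hp : ‖p‖ < 1) (x : ℂ) :
    Summable fun n : ℕ ↦ ‖p ^ (n + 1) * x‖ := by
  simp only [norm_mul, norm_pow]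
  exact ((summable_nat_add_iff 1).mpr
    (summable_geometric_of_lt_one (norm_nonneg _) hp)).mul_right _

theorem multipliable_eulerProd {p : ℂ} (hp : ‖p‖ < 1) (x : ℂ) :
    Multipliable fun n : ℕ ↦ 1 - p ^ (n + 1) * x := by
  simp_rw [sub_eq_add_neg]
  apply multipliable_one_add_of_summable
  simpa using! summable_pow_succ_mul hp x

theorem eulerProd_ne_zero {p x : ℂ} (hp : ‖p‖ < 1) (hx : ∀ n : ℕ, 1 - p ^ (n + 1) * x ≠ 0) :
    eulerProd p x ≠ 0 := by
  simp_rw [eulerProd, sub_eq_add_neg]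
  refine tprod_one_add_ne_zero_of_summable (f := fun n ↦ -(p ^ (n + 1) * x)) ?_ ?_
  · simpa [sub_eq_add_neg] using hx
  · simpa using! summable_pow_succ_mul hp x

theorem eulerProd_one_ne_zero {p : ℂ} (hp : ‖p‖ < 1) : eulerProd p 1 ≠ 0 :=
  eulerProd_ne_zero hp fun n ↦ by simpa using one_sub_pow_ne_zero hp n

theorem tendsto_eulerProd {p : ℂ} (hp : ‖p‖ < 1) (x : ℂ) :
    Tendsto (fun n ↦ ∏ j ∈ Finset.range n, (1 - p ^ (j + 1) * x)) atTop (𝓝 (eulerProd p x)) :=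
  (multipliable_eulerProd hp x).hasProd.tendsto_prod_nat

theorem tendsto_eulerPartial {p : ℂ} (hp : ‖p‖ < 1) :
    Tendsto (eulerPartial p) atTop (𝓝 (eulerProd p 1)) := by
  simpa [eulerPartial] using! tendsto_eulerProd hp 1

theorem tendsto_invEuler {p : ℂ} (hp : ‖p‖ < 1) :
    Tendsto (invEuler p) atTop (𝓝 (eulerProd p 1)⁻¹) := by
  have h : Tendsto (fun m : ℤ ↦ (eulerPartial p m.toNat)⁻¹) atTop (𝓝 (eulerProd p 1)⁻¹) :=
    ((tendsto_eulerPartial hp).inv₀ (eulerProd_one_ne_zero hp)).comp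
      (tendsto_atTop_atTop.mpr fun n ↦ ⟨n, fun m hm ↦ by omega⟩)
  refine h.congr' ?_
  filter_upwards [eventually_ge_atTop 0] with m hm
  simp [invEuler, hm]

theorem exists_norm_eulerPartial_le {p : ℂ} (hp : ‖p‖ < 1) :
    ∃ C, 0 ≤ C ∧ ∀ n, ‖eulerPartial p n‖ ≤ C := by
  obtain ⟨C, hC⟩ := (tendsto_eulerPartial hp).norm.bddAbove_range
  exact ⟨C, (norm_nonneg _).trans (hC ⟨0, rfl⟩), fun n ↦ hC ⟨n, rfl⟩⟩

theorem exists_norm_invEuler_le {p : ℂ} (hp : ‖p‖ < 1) :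
    ∃ C, 0 ≤ C ∧ ∀ m, ‖invEuler p m‖ ≤ C := by
  obtain ⟨C, hC⟩ :=
    ((tendsto_eulerPartial hp).inv₀ (eulerProd_one_ne_zero hp)).norm.bddAbove_range
  have h0 : 0 ≤ C := (norm_nonneg _).trans (hC ⟨0, rfl⟩)
  refine ⟨C, h0, fun m ↦ ?_⟩
  unfold invEuler
  split_ifs
  · simpa using h0
  · exact hC ⟨m.toNat, rfl⟩

/-- The coefficients of the finite form of the triple product. -/
def tripleCoeff (p : ℂ) (n : ℕ) (k : ℤ) : ℂ :=
  eulerPartial p (2 * n) * (invEuler p (n - k) * invEuler p (n + k))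

/-- The coefficient is the Gaussian binomial of 2n over n + k, and this is the q-Pascal rule applied
twice. It mirrors multiplication of the finite product by (1 - p^(n+1)w)(1 - p^n w⁻¹). -/
theorem tripleCoeff_succ {p : ℂ} (hp : ‖p‖ < 1) (hp0 : p ≠ 0) (n : ℕ) (k : ℤ) :
    tripleCoeff p (n + 1) k = (1 + p ^ (2 * n + 1)) * tripleCoeff p n k +
      p ^ ((n : ℤ) + 1 - k) * tripleCoeff p n (k - 1) +
      p ^ ((n : ℤ) + 1 + k) * tripleCoeff p n (k + 1) := by
  have e1 : invEuler p (n - k) =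
      (1 - p ^ ((n : ℤ) + 1 - k)) * invEuler p (n + 1 - k) := by
    rw [← invEuler_sub_one hp]; congr 1; ring
  have e2 : invEuler p (n + k) =
      (1 - p ^ ((n : ℤ) + 1 + k)) * invEuler p (n + 1 + k) := by
    rw [← invEuler_sub_one hp]; congr 1; ring
  have e3 : invEuler p (n + (k - 1)) =
      (1 - p ^ ((n : ℤ) + 1 + k) / p) *
        ((1 - p ^ ((n : ℤ) + 1 + k)) * invEuler p (n + 1 + k)) := by
    rw [← e2, div_eq_mul_inv, ← zpow_sub_one₀ hp0, show (n : ℤ) + 1 + k - 1 = n + k by ring, ← invEuler_sub_one hp]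
    congr 1; ring
  have e4 : invEuler p (n - (k + 1)) =
      (1 - p ^ ((n : ℤ) + 1 - k) / p) *
        ((1 - p ^ ((n : ℤ) + 1 - k)) * invEuler p (n + 1 - k)) := by
    rw [← e1, div_eq_mul_inv, ← zpow_sub_one₀ hp0, show (n : ℤ) + 1 - k - 1 = n - k by ring, ← invEuler_sub_one hp]
    congr 1; ring
  have e5 : p ^ (2 * n + 2) = p ^ ((n : ℤ) + 1 - k) * p ^ ((n : ℤ) + 1 + k) := by
    rw [← zpow_add₀ hp0, ← zpow_natCast]; congr 1; push_cast; ring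
  have e6 : p ^ (2 * n + 1) = p ^ ((n : ℤ) + 1 - k) * p ^ ((n : ℤ) + 1 + k) / p := by
    rw [← e5, pow_succ p (2 * n + 1), mul_div_cancel_right₀ _ hp0]
  have e7 : eulerPartial p (2 * (n + 1)) =
      eulerPartial p (2 * n) * (1 - p ^ (2 * n + 1)) * (1 - p ^ (2 * n + 2)) := by
    rw [show 2 * (n + 1) = 2 * n + 1 + 1 by ring, eulerPartial_succ, eulerPartial_succ]
  have e8 : (n : ℤ) - (k - 1) = n + 1 - k := by ring
  have e9 : (n : ℤ) + (k + 1) = n + 1 + k := by ring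
  simp only [tripleCoeff, e7, e8, e9, Nat.cast_add, Nat.cast_one]
  rw [e1, e2, e3, e4, e6, e5]
  field_simp
  ring

/-- The function `θ(z, σ) = exp(πiz) ∑ (-1)^n exp(2πinz + πi(n² + n)σ)`, the odd theta function up
to a factor that depends only on `σ`. -/
def oddTheta (z σ : ℂ) : ℂ :=
  Complex.exp (Real.pi * Complex.I * z) * jacobiTheta₂ (z + (1 + σ) / 2) σ

/-- The q-binomial theorem in symmetric form, by induction on n: the theta terms are (-1)^k
p^(k(k+1)/2) w^k with w = exp(2πiz). Summing over all of ℤ is harmless because the coefficient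
vanishes for |k| > n. -/
theorem hasSum_finite_triple {σ : ℂ} (hσ : 0 < σ.im) (z : ℂ) (n : ℕ) :
    HasSum (fun k : ℤ ↦ jacobiTheta₂_term k (z + (1 + σ) / 2) σ *
        tripleCoeff (Complex.exp (2 * Real.pi * Complex.I * σ)) n k)
      (∏ j ∈ Finset.range n,
        ((1 - Complex.exp (2 * Real.pi * Complex.I * σ) ^ (j + 1) *
            Complex.exp (2 * Real.pi * Complex.I * z)) *
          (1 - Complex.exp (2 * Real.pi * Complex.I * σ) ^ j *
            (Complex.exp (2 * Real.pi * Complex.I * z))⁻¹))) := by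
  set p := Complex.exp (2 * Real.pi * Complex.I * σ) with hpdef
  set w := Complex.exp (2 * Real.pi * Complex.I * z) with hwdef
  have hp0 : p ≠ 0 := Complex.exp_ne_zero _
  have hw0 : w ≠ 0 := Complex.exp_ne_zero _
  have hp : ‖p‖ < 1 := norm_exp_two_pi_I_lt_one ⟨σ, hσ⟩
  set c : ℤ → ℂ := fun k ↦ jacobiTheta₂_term k (z + (1 + σ) / 2) σ with hc
  have hcs : ∀ k, c (k + 1) = -(p ^ (k + 1) * w) * c k := by
    intro k
    have h1 : p ^ (k + 1) = Complex.exp ((k + 1) * (2 * Real.pi * Complex.I * σ)) := by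
      rw [hpdef, ← Complex.exp_int_mul]; push_cast; rfl
    rw [h1, hwdef, neg_mul, ← Complex.exp_add]
    simp only [hc, jacobiTheta₂_term]
    rw [← Complex.exp_add, ← neg_one_mul, ← Complex.exp_pi_mul_I, ← Complex.exp_add]
    congr 1
    push_cast
    ring
  change HasSum (fun k ↦ c k * tripleCoeff p n k) _
  induction n with
  | zero =>
    have h : (fun k ↦ c k * tripleCoeff p 0 k) = fun k ↦ if k = 0 then 1 else 0 := by
      funext k
      rcases lt_trichotomy k 0 with h | rfl | h
      · simp [tripleCoeff, invEuler, h, h.ne]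
      · simp [tripleCoeff, invEuler, eulerPartial, hc, jacobiTheta₂_term]
      · simp [tripleCoeff, invEuler, h, h.ne']
    rw [h]
    simpa using hasSum_ite_eq (0 : ℤ) (1 : ℂ)
  | succ n ih =>
    have s1 := (Equiv.subRight (1 : ℤ)).hasSum_iff.mpr ih
    have s2 := (Equiv.addRight (1 : ℤ)).hasSum_iff.mpr ih
    have s := ((ih.mul_left (1 + p ^ (2 * n + 1))).add (s1.mul_left (-(p ^ (n + 1) * w)))).add
      (s2.mul_left (-(p ^ n * w⁻¹)))
    have hv (P : ℂ) : P * ((1 - p ^ (n + 1) * w) * (1 - p ^ n * w⁻¹)) =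
        (1 + p ^ (2 * n + 1)) * P + -(p ^ (n + 1) * w) * P + -(p ^ n * w⁻¹) * P := by
      field_simp
      ring
    rw [Finset.prod_range_succ, hv]
    refine (congrArg (fun f ↦ HasSum f _) (funext fun k ↦ ?_)).mpr s
    simp only [Function.comp, Equiv.subRight_apply, Equiv.coe_addRight]
    rw [tripleCoeff_succ hp hp0, hcs k]
    have h2 := hcs (k - 1)
    rw [sub_add_cancel] at h2
    have h3 : c (k - 1) = -(p ^ (-k) * w⁻¹) * c k := by
      rw [h2, zpow_neg]
      field_simp
    rw [h3]
    have h4 : p ^ ((n : ℤ) + 1 - k) = p ^ (n + 1) * p ^ (-k) := by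
      rw [← zpow_natCast p (n + 1), ← zpow_add₀ hp0]; congr 1
    have h5 : p ^ ((n : ℤ) + 1 + k) = p ^ n * p ^ (k + 1) := by
      rw [← zpow_natCast p n, ← zpow_add₀ hp0]; congr 1; ring
    rw [h4, h5]
    field_simp

/-- The Jacobi triple product. -/
theorem oddTheta_eq_prod {σ : ℂ} (hσ : 0 < σ.im) (z : ℂ) :
    oddTheta z σ = Complex.exp (Real.pi * Complex.I * z) *
      (1 - (Complex.exp (2 * Real.pi * Complex.I * z))⁻¹) *
      (eulerProd (Complex.exp (2 * Real.pi * Complex.I * σ)) 1 *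
       eulerProd (Complex.exp (2 * Real.pi * Complex.I * σ))
        (Complex.exp (2 * Real.pi * Complex.I * z)) *
       eulerProd (Complex.exp (2 * Real.pi * Complex.I * σ))
        (Complex.exp (2 * Real.pi * Complex.I * z))⁻¹) := by
  have key := hasSum_finite_triple hσ z
  set p := Complex.exp (2 * Real.pi * Complex.I * σ) with hpdef
  set w := Complex.exp (2 * Real.pi * Complex.I * z) with hwdef
  have hp : ‖p‖ < 1 := norm_exp_two_pi_I_lt_one ⟨σ, hσ⟩
  have hE := eulerProd_one_ne_zero hp
  obtain ⟨C, hC0, hC⟩ := exists_norm_eulerPartial_le hp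
  obtain ⟨D, hD0, hD⟩ := exists_norm_invEuler_le hp
  have hcoeff (k : ℤ) :
      Tendsto (fun n : ℕ ↦ tripleCoeff p n k) atTop (𝓝 (eulerProd p 1)⁻¹) := by
    have a1 : Tendsto (fun n : ℕ ↦ eulerPartial p (2 * n)) atTop (𝓝 (eulerProd p 1)) :=
      (tendsto_eulerPartial hp).comp (tendsto_atTop_atTop.mpr fun n ↦ ⟨n, fun m hm ↦ by omega⟩)
    have a2 : Tendsto (fun n : ℕ ↦ invEuler p (n - k)) atTop (𝓝 (eulerProd p 1)⁻¹) :=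
      (tendsto_invEuler hp).comp
        (tendsto_atTop_atTop.mpr fun n ↦ ⟨(n + k).toNat, fun m hm ↦ by omega⟩)
    have a3 : Tendsto (fun n : ℕ ↦ invEuler p (n + k)) atTop (𝓝 (eulerProd p 1)⁻¹) :=
      (tendsto_invEuler hp).comp
        (tendsto_atTop_atTop.mpr fun n ↦ ⟨(n - k).toNat, fun m hm ↦ by omega⟩)
    have := a1.mul (a2.mul a3)
    rwa [mul_inv_cancel_left₀ hE] at this
  -- As n grows every Gaussian binomial tends to 1/∏(1 - p^j), and they are bounded uniformly in n
  -- and k, so dominated convergence applies.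
  have lim1 : Tendsto (fun n : ℕ ↦ ∑' k : ℤ, jacobiTheta₂_term k (z + (1 + σ) / 2) σ *
      tripleCoeff p n k) atTop
      (𝓝 (∑' k : ℤ, jacobiTheta₂_term k (z + (1 + σ) / 2) σ * (eulerProd p 1)⁻¹)) := by
    refine tendsto_tsum_of_dominated_convergence
      (bound := fun k : ℤ ↦ ‖jacobiTheta₂_term k (z + (1 + σ) / 2) σ‖ * (C * (D * D))) ?_ ?_ ?_
    · exact ((summable_jacobiTheta₂_term_iff _ _).mpr hσ).norm.mul_right _
    · exact fun k ↦ (hcoeff k).const_mul _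
    · refine .of_forall fun n k ↦ ?_
      rw [norm_mul]
      gcongr
      rw [tripleCoeff, norm_mul, norm_mul]
      gcongr
      exacts [hC _, hD _, hD _]
  rw [tsum_mul_right] at lim1
  have lim2 : Tendsto (fun n : ℕ ↦ ∑' k : ℤ, jacobiTheta₂_term k (z + (1 + σ) / 2) σ *
      tripleCoeff p n k) atTop
      (𝓝 (eulerProd p w * ((1 - w⁻¹) * eulerProd p w⁻¹))) := by
    simp_rw [fun n ↦ (key n).tsum_eq, Finset.prod_mul_distrib]
    refine (tendsto_eulerProd hp w).mul ?_
    -- The second family of factors starts at j = 0; the index shift splits off 1 - w⁻¹.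
    rw [← tendsto_add_atTop_iff_nat 1]
    simp_rw [Finset.prod_range_succ', pow_zero, one_mul]
    rw [mul_comm]
    exact (tendsto_eulerProd hp w⁻¹).mul_const _
  have := tendsto_nhds_unique lim1 lim2
  rw [oddTheta, jacobiTheta₂, ← div_mul_cancel₀ (∑' n, jacobiTheta₂_term n (z + (1 + σ) / 2) σ) hE,
    div_eq_mul_inv, this]
  ring

/-! ### The odd theta function -/

theorem differentiable_oddTheta {σ : ℂ} (hσ : 0 < σ.im) :
    Differentiable ℂ fun z ↦ oddTheta z σ := by
  intro z
  have h := (differentiableAt_jacobiTheta₂_fst (z + (1 + σ) / 2) hσ).comp z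
    (f := fun z : ℂ ↦ z + (1 + σ) / 2) (by fun_prop)
  exact DifferentiableAt.mul (by fun_prop) h

theorem oddTheta_neg (z σ : ℂ) : oddTheta (-z) σ = -oddTheta z σ := by
  have h1 : jacobiTheta₂ (-z + (1 + σ) / 2) σ = jacobiTheta₂ (z - (1 + σ) / 2) σ := by
    rw [← jacobiTheta₂_neg_left]; congr 1; ring
  have h2 : jacobiTheta₂ (z + (1 + σ) / 2) σ = Complex.exp (Real.pi * Complex.I) *
      Complex.exp (-(2 * Real.pi * Complex.I * z)) * jacobiTheta₂ (z - (1 + σ) / 2) σ := by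
    rw [show z + (1 + σ) / 2 = z - (1 + σ) / 2 + σ + 1 by ring, jacobiTheta₂_add_left,
      jacobiTheta₂_add_left', ← Complex.exp_add]
    congr 2
    ring
  rw [oddTheta, oddTheta, h1, h2, ← mul_assoc, mul_left_comm, ← Complex.exp_add,
    Complex.exp_pi_mul_I, neg_one_mul, neg_mul, neg_neg]
  congr 2
  ring

theorem oddTheta_zero (σ : ℂ) : oddTheta 0 σ = 0 := by
  have := oddTheta_neg 0 σ
  rw [neg_zero] at this
  exact self_eq_neg.mp this

theorem oddTheta_add_one (z σ : ℂ) : oddTheta (z + 1) σ = -oddTheta z σ := by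
  rw [oddTheta, oddTheta, show z + 1 + (1 + σ) / 2 = z + (1 + σ) / 2 + 1 by ring,
    jacobiTheta₂_add_left, mul_add, mul_one, Complex.exp_add, Complex.exp_pi_mul_I]
  ring

theorem oddTheta_add_period (z σ : ℂ) :
    oddTheta (z + σ) σ = -Complex.exp (-(Real.pi * Complex.I * (σ + 2 * z))) * oddTheta z σ := by
  have e : Complex.exp (Real.pi * Complex.I * (z + σ)) *
      Complex.exp (-Real.pi * Complex.I * (σ + 2 * (z + (1 + σ) / 2))) =
      Complex.exp (-(Real.pi * Complex.I)) * (Complex.exp (-(Real.pi * Complex.I * (σ + 2 * z))) *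
        Complex.exp (Real.pi * Complex.I * z)) := by
    simp only [← Complex.exp_add]
    congr 1
    ring
  rw [oddTheta, oddTheta, show z + σ + (1 + σ) / 2 = z + (1 + σ) / 2 + σ by ring,
    jacobiTheta₂_add_left', ← mul_assoc, e, Complex.exp_neg, Complex.exp_pi_mul_I]
  norm_num [mul_assoc]

theorem oddTheta_add_int (z σ : ℂ) (n : ℤ) : oddTheta (z + n) σ = (-1) ^ n * oddTheta z σ := by
  induction n with
  | zero => simp
  | succ n ih =>
    push_cast at ih ⊢
    rw [← add_assoc, oddTheta_add_one, ih, zpow_add_one₀ (by norm_num)]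
    ring
  | pred n ih =>
    have h := oddTheta_add_one (z + (-(n : ℤ) - 1 : ℤ)) σ
    rw [show z + ((-(n : ℤ) - 1 : ℤ) : ℂ) + 1 = z + (-(n : ℤ) : ℤ) by push_cast; ring, ih] at h
    rw [zpow_sub_one₀ (by norm_num), ← neg_eq_iff_eq_neg.mpr h]
    ring

theorem oddTheta_add_int_mul (z σ : ℂ) (n : ℤ) :
    oddTheta (z + n * σ) σ =
      (-1) ^ n * Complex.exp (-(Real.pi * Complex.I * (n ^ 2 * σ + 2 * n * z))) * oddTheta z σ := by
  have step (n : ℤ) (E : ℂ) (hE : E = Complex.exp (-(Real.pi * Complex.I *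
      (σ + 2 * (z + n * σ))))) : oddTheta (z + (n + 1 : ℤ) * σ) σ = -E * oddTheta (z + n * σ) σ := by
    rw [hE, ← oddTheta_add_period]; congr 1; push_cast; ring
  induction n with
  | zero => simp
  | succ n ih =>
    rw [step n _ rfl, ih, zpow_add_one₀ (by norm_num)]
    have : Complex.exp (-(Real.pi * Complex.I * (((n + 1 : ℤ) : ℂ) ^ 2 * σ +
        2 * ((n + 1 : ℤ) : ℂ) * z))) = Complex.exp (-(Real.pi * Complex.I *
          (σ + 2 * (z + (n : ℤ) * σ)))) * Complex.exp (-(Real.pi * Complex.I *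
            (((n : ℤ) : ℂ) ^ 2 * σ + 2 * ((n : ℤ) : ℂ) * z))) := by
      rw [← Complex.exp_add]; congr 1; push_cast; ring
    rw [this]
    ring
  | pred n ih =>
    have h := step (-(n : ℤ) - 1) _ rfl
    rw [show -(n : ℤ) - 1 + 1 = -n by ring, ih] at h
    have : Complex.exp (-(Real.pi * Complex.I * (((-(n : ℤ) : ℤ) : ℂ) ^ 2 * σ +
        2 * ((-(n : ℤ) : ℤ) : ℂ) * z))) = Complex.exp (-(Real.pi * Complex.I *
          (σ + 2 * (z + (-(n : ℤ) - 1 : ℤ) * σ)))) * Complex.exp (-(Real.pi * Complex.I *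
            (((-(n : ℤ) - 1 : ℤ) : ℂ) ^ 2 * σ + 2 * ((-(n : ℤ) - 1 : ℤ) : ℂ) * z))) := by
      rw [← Complex.exp_add]; congr 1; push_cast; ring
    rw [this] at h
    rw [zpow_sub_one₀ (by norm_num)]
    refine mul_left_cancel₀ (Complex.exp_ne_zero (-(Real.pi * Complex.I *
          (σ + 2 * (z + (-(n : ℤ) - 1 : ℤ) * σ))))) ?_
    linear_combination h

/-! ### Logarithmic derivative and derivative at zero of the odd theta function. -/

theorem multipliableLocallyUniformlyOn_eulerProd {p : ℂ} (hp : ‖p‖ < 1) (R : ℝ) :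
    MultipliableLocallyUniformlyOn (fun (n : ℕ) x ↦ 1 - p ^ (n + 1) * x) (Metric.ball 0 R) := by
  simp_rw [sub_eq_add_neg]
  refine Summable.multipliableLocallyUniformlyOn_nat_one_add Metric.isOpen_ball
    (u := fun n ↦ ‖p‖ ^ (n + 1) * R)
    (((summable_nat_add_iff 1).mpr (summable_geometric_of_lt_one (norm_nonneg _) hp)).mul_right _)
    (.of_forall fun n x hx ↦ ?_) (fun _ ↦ by fun_prop)
  rw [norm_neg, norm_mul, norm_pow]
  gcongr
  exact (mem_ball_zero_iff.mp hx).le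

theorem differentiable_eulerProd {p : ℂ} (hp : ‖p‖ < 1) : Differentiable ℂ (eulerProd p) := by
  intro x
  have hx : x ∈ Metric.ball (0 : ℂ) (‖x‖ + 1) := by simp
  refine ((multipliableLocallyUniformlyOn_eulerProd hp
    (‖x‖ + 1)).hasProdLocallyUniformlyOn.differentiableOn (.of_forall fun _ ↦ ?_)
    Metric.isOpen_ball).differentiableAt (Metric.isOpen_ball.mem_nhds hx)
  simpa [Finset.prod_fn] using DifferentiableOn.finsetProd (fun _ _ ↦ by fun_prop)

theorem summable_lambert {p : ℂ} (hp : ‖p‖ < 1) (x : ℂ) :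
    Summable fun n : ℕ ↦ p ^ (n + 1) * x / (1 - p ^ (n + 1) * x) := by
  have h0 : Tendsto (fun n : ℕ ↦ ‖1 - p ^ (n + 1) * x‖) atTop (𝓝 1) := by
    have h := (summable_pow_succ_mul hp x).of_norm.tendsto_atTop_zero
    simpa using (h.const_sub 1).norm
  refine Summable.of_norm_bounded_eventually_nat
    (g := fun n ↦ 2 * ‖p ^ (n + 1) * x‖) ((summable_pow_succ_mul hp x).mul_left 2) ?_
  filter_upwards [h0.eventually (lt_mem_nhds (show (1 / 2 : ℝ) < 1 by norm_num))] with n hn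
  rw [norm_div, div_le_iff₀ (by linarith)]
  nlinarith [norm_nonneg (p ^ (n + 1) * x)]

theorem mul_logDeriv_eulerProd {p x : ℂ} (hp : ‖p‖ < 1)
    (hx : ∀ n : ℕ, 1 - p ^ (n + 1) * x ≠ 0) :
    x * logDeriv (eulerProd p) x = -∑' n : ℕ, p ^ (n + 1) * x / (1 - p ^ (n + 1) * x) := by
  rcases eq_or_ne x 0 with rfl | hx0
  · simp
  have hl (n : ℕ) : logDeriv (fun x ↦ 1 - p ^ (n + 1) * x) x =
      -x⁻¹ * (p ^ (n + 1) * x / (1 - p ^ (n + 1) * x)) := by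
    have : HasDerivAt (fun x ↦ 1 - p ^ (n + 1) * x) (-(p ^ (n + 1) * 1)) x :=
      ((hasDerivAt_id x).const_mul _).const_sub 1
    rw [logDeriv_apply, this.deriv]
    field_simp
  have := logDeriv_tprod_eq_tsum (s := Metric.ball 0 (‖x‖ + 1)) Metric.isOpen_ball (x := x)
    (by simp) hx (fun _ ↦ by fun_prop) (by simp_rw [hl]; exact (summable_lambert hp x).mul_left _)
    (multipliableLocallyUniformlyOn_eulerProd hp _) (eulerProd_ne_zero hp hx)
  change x * logDeriv (fun x ↦ ∏' n : ℕ, (1 - p ^ (n + 1) * x)) x = _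
  rw [this]
  simp_rw [hl]
  rw [tsum_mul_left]
  field_simp

theorem hasDerivAt_exp_two_pi (z : ℂ) :
    HasDerivAt (fun z ↦ Complex.exp (2 * Real.pi * Complex.I * z))
      (Complex.exp (2 * Real.pi * Complex.I * z) * (2 * Real.pi * Complex.I)) z := by
  simpa using ((hasDerivAt_id z).const_mul (2 * Real.pi * Complex.I)).cexp

theorem oddTheta_ne_zero {σ z : ℂ} (hσ : 0 < σ.im)
    (h0 : Complex.exp (2 * Real.pi * Complex.I * z) ≠ 1)
    (h1 : ∀ n : ℕ, 1 - Complex.exp (2 * Real.pi * Complex.I * σ) ^ (n + 1) *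
      Complex.exp (2 * Real.pi * Complex.I * z) ≠ 0)
    (h2 : ∀ n : ℕ, 1 - Complex.exp (2 * Real.pi * Complex.I * σ) ^ (n + 1) *
      (Complex.exp (2 * Real.pi * Complex.I * z))⁻¹ ≠ 0) : oddTheta z σ ≠ 0 := by
  have hp : ‖Complex.exp (2 * Real.pi * Complex.I * σ)‖ < 1 := norm_exp_two_pi_I_lt_one ⟨σ, hσ⟩
  rw [oddTheta_eq_prod hσ]
  refine mul_ne_zero (mul_ne_zero (Complex.exp_ne_zero _) ?_) (mul_ne_zero (mul_ne_zero
    (eulerProd_one_ne_zero hp) (eulerProd_ne_zero hp h1)) (eulerProd_ne_zero hp h2))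
  rw [sub_ne_zero, ne_comm, ne_eq, inv_eq_one]
  exact h0

theorem logDeriv_oddTheta {σ z : ℂ} (hσ : 0 < σ.im)
    (h0 : Complex.exp (2 * Real.pi * Complex.I * z) ≠ 1)
    (h1 : ∀ n : ℕ, 1 - Complex.exp (2 * Real.pi * Complex.I * σ) ^ (n + 1) *
      Complex.exp (2 * Real.pi * Complex.I * z) ≠ 0)
    (h2 : ∀ n : ℕ, 1 - Complex.exp (2 * Real.pi * Complex.I * σ) ^ (n + 1) *
      (Complex.exp (2 * Real.pi * Complex.I * z))⁻¹ ≠ 0) :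
    logDeriv (fun z ↦ oddTheta z σ) z = Real.pi * Complex.I +
      2 * Real.pi * Complex.I * (1 / (Complex.exp (2 * Real.pi * Complex.I * z) - 1) -
      ∑' n : ℕ, Complex.exp (2 * Real.pi * Complex.I * σ) ^ (n + 1) *
        Complex.exp (2 * Real.pi * Complex.I * z) /
        (1 - Complex.exp (2 * Real.pi * Complex.I * σ) ^ (n + 1) *
          Complex.exp (2 * Real.pi * Complex.I * z)) +
      ∑' n : ℕ, Complex.exp (2 * Real.pi * Complex.I * σ) ^ (n + 1) *
        (Complex.exp (2 * Real.pi * Complex.I * z))⁻¹ /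
        (1 - Complex.exp (2 * Real.pi * Complex.I * σ) ^ (n + 1) *
          (Complex.exp (2 * Real.pi * Complex.I * z))⁻¹)) := by
  have hp : ‖Complex.exp (2 * Real.pi * Complex.I * σ)‖ < 1 := norm_exp_two_pi_I_lt_one ⟨σ, hσ⟩
  set p := Complex.exp (2 * Real.pi * Complex.I * σ) with hpdef
  have hfun : (fun z ↦ oddTheta z σ) = fun z ↦ Complex.exp (Real.pi * Complex.I * z) *
      (1 - (Complex.exp (2 * Real.pi * Complex.I * z))⁻¹) *
      (eulerProd p 1 * eulerProd p (Complex.exp (2 * Real.pi * Complex.I * z)) *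
        eulerProd p (Complex.exp (2 * Real.pi * Complex.I * z))⁻¹) :=
    funext fun z ↦ oddTheta_eq_prod hσ z
  have hw := hasDerivAt_exp_two_pi z
  have hwi := hw.inv (Complex.exp_ne_zero _)
  have hE := differentiable_eulerProd hp
  have d1 := (hE (Complex.exp (2 * Real.pi * Complex.I * z))).hasDerivAt.comp z hw
  have d2 := (hE (Complex.exp (2 * Real.pi * Complex.I * z))⁻¹).hasDerivAt.comp z hwi
  have d3 : HasDerivAt (fun z ↦ Complex.exp (Real.pi * Complex.I * z))
      (Complex.exp (Real.pi * Complex.I * z) * (Real.pi * Complex.I)) z := by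
    simpa using ((hasDerivAt_id z).const_mul (Real.pi * Complex.I)).cexp
  have d4 := hwi.const_sub 1
  have n1 := eulerProd_ne_zero hp h1
  have n2 := eulerProd_ne_zero hp h2
  have n0 := eulerProd_one_ne_zero hp
  have d := ((d3.mul d4).mul ((d1.const_mul (eulerProd p 1)).mul d2)).deriv
  have l1 := mul_logDeriv_eulerProd hp h1
  have l2 := mul_logDeriv_eulerProd hp h2
  rw [← neg_eq_iff_eq_neg] at l1 l2
  rw [← l1, ← l2, hfun, logDeriv_apply]
  refine (congrArg (· / _) d).trans ?_
  simp only [logDeriv_apply, Pi.mul_apply, Pi.inv_apply, Function.comp_apply]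
  have n3 : Complex.exp (2 * Real.pi * Complex.I * z) - 1 ≠ 0 := sub_ne_zero.mpr h0
  have n4 := Complex.exp_ne_zero (2 * Real.pi * Complex.I * z)
  have n5 := Complex.exp_ne_zero (Real.pi * Complex.I * z)
  set w := Complex.exp (2 * Real.pi * Complex.I * z)
  have n6 : 1 - w⁻¹ ≠ 0 := by
    rw [sub_ne_zero, ne_comm, ne_eq, inv_eq_one]; exact h0
  have n7 : (w - 1)⁻¹ = w⁻¹ / (1 - w⁻¹) := by field_simp
  rw [one_div, n7]
  generalize eulerProd p w = a at n1 ⊢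
  generalize eulerProd p w⁻¹ = b at n2 ⊢
  generalize deriv (eulerProd p) w⁻¹ = b'
  have n8 : w⁻¹ ≠ 0 := inv_ne_zero n4
  rw [show -(w * (2 * Real.pi * Complex.I)) / w ^ 2 = -(2 * Real.pi * Complex.I) * w⁻¹ by
    field_simp]
  field_simp
  ring

/-- In the triple product only 1 - w⁻¹ vanishes at z = 0, so the derivative is 2πi times the
remaining factors there, which are three copies of the same Euler product. -/
theorem deriv_oddTheta_zero {σ : ℂ} (hσ : 0 < σ.im) :
    deriv (fun z ↦ oddTheta z σ) 0 =
      2 * Real.pi * Complex.I * eulerProd (Complex.exp (2 * Real.pi * Complex.I * σ)) 1 ^ 3 := by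
  have hp : ‖Complex.exp (2 * Real.pi * Complex.I * σ)‖ < 1 := norm_exp_two_pi_I_lt_one ⟨σ, hσ⟩
  set p := Complex.exp (2 * Real.pi * Complex.I * σ) with hpdef
  have hfun : (fun z ↦ oddTheta z σ) = fun z ↦
      (1 - (Complex.exp (2 * Real.pi * Complex.I * z))⁻¹) *
      (Complex.exp (Real.pi * Complex.I * z) *
        (eulerProd p 1 * eulerProd p (Complex.exp (2 * Real.pi * Complex.I * z)) *
        eulerProd p (Complex.exp (2 * Real.pi * Complex.I * z))⁻¹)) := by
    funext z
    rw [oddTheta_eq_prod hσ z]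
    ring
  have hE := differentiable_eulerProd hp
  have d1 : HasDerivAt (fun z ↦ 1 - (Complex.exp (2 * Real.pi * Complex.I * z))⁻¹)
      (2 * Real.pi * Complex.I) 0 := by
    simpa using ((hasDerivAt_exp_two_pi 0).inv (Complex.exp_ne_zero _)).const_sub 1
  have d2 : DifferentiableAt ℂ (fun z ↦ Complex.exp (Real.pi * Complex.I * z) *
        (eulerProd p 1 * eulerProd p (Complex.exp (2 * Real.pi * Complex.I * z)) *
        eulerProd p (Complex.exp (2 * Real.pi * Complex.I * z))⁻¹)) 0 := by
    have e1 := (hasDerivAt_exp_two_pi 0).differentiableAt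
    have e2 := e1.inv (Complex.exp_ne_zero _)
    exact DifferentiableAt.mul (by fun_prop) (((hE _).comp (0 : ℂ) e1).const_mul _ |>.mul
      ((hE _).comp (0 : ℂ) e2))
  rw [hfun, (d1.fun_mul d2.hasDerivAt).deriv]
  simp
  ring

/-! ### The three-term relation -/

/-- The even part of the second order theta functions, `∑ exp(2πi(2k)x + πi(2k)²σ/2)`. -/
def evenTheta (x σ : ℂ) : ℂ := jacobiTheta₂ (2 * x) (2 * σ)

/-- The odd part of the second order theta functions,
`∑ exp(2πi(2k+1)x + πi(2k+1)²σ/2)`. -/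
def halfTheta (x σ : ℂ) : ℂ :=
  Complex.exp (2 * Real.pi * Complex.I * x + Real.pi * Complex.I * σ / 2) *
    jacobiTheta₂ (2 * x + σ) (2 * σ)

theorem hasSum_jacobiTheta₂_mul (z z' : ℂ) {σ σ' : ℂ} (hσ : 0 < σ.im) (hσ' : 0 < σ'.im) :
    HasSum (fun k : ℤ × ℤ ↦ jacobiTheta₂_term k.1 z σ * jacobiTheta₂_term k.2 z' σ')
      (jacobiTheta₂ z σ * jacobiTheta₂ z' σ') := by
  have h1 := ((summable_jacobiTheta₂_term_iff z σ).mpr hσ).norm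
  have h2 := ((summable_jacobiTheta₂_term_iff z' σ').mpr hσ').norm
  rw [jacobiTheta₂, jacobiTheta₂, tsum_mul_tsum_of_summable_norm h1 h2]
  exact (summable_mul_of_summable_norm h1 h2).hasSum

/-- The pairs (m, n) split by the parity of m + n, and each class is parametrized by sum and
difference coordinates. -/
theorem hasSum_of_parity {f : ℤ × ℤ → ℂ} {a b : ℂ}
    (ha : HasSum (fun k : ℤ × ℤ ↦ f (k.1 + k.2, k.1 - k.2)) a)
    (hb : HasSum (fun k : ℤ × ℤ ↦ f (k.1 + k.2, k.1 - k.2 - 1)) b) : HasSum f (a + b) := by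
  have i1 : Function.Injective fun k : ℤ × ℤ ↦ (k.1 + k.2, k.1 - k.2) := by
    rintro ⟨a, b⟩ ⟨c, d⟩ h
    simp only [Prod.mk.injEq] at h ⊢
    omega
  have i2 : Function.Injective fun k : ℤ × ℤ ↦ (k.1 + k.2, k.1 - k.2 - 1) := by
    rintro ⟨a, b⟩ ⟨c, d⟩ h
    simp only [Prod.mk.injEq] at h ⊢
    omega
  refine HasSum.add_isCompl (s := Set.range fun k : ℤ × ℤ ↦ (k.1 + k.2, k.1 - k.2))
    (t := Set.range fun k : ℤ × ℤ ↦ (k.1 + k.2, k.1 - k.2 - 1)) ?_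
    (i1.hasSum_range_iff.mpr ha) (i2.hasSum_range_iff.mpr hb)
  constructor
  · rw [Set.disjoint_left]
    rintro _ ⟨⟨a, b⟩, rfl⟩ ⟨⟨c, d⟩, h⟩
    simp only [Prod.mk.injEq] at h
    omega
  · rw [codisjoint_iff_le_sup]
    rintro ⟨m, n⟩ -
    rcases Int.even_or_odd (m + n) with ⟨k, hk⟩ | ⟨k, hk⟩
    · exact Or.inl ⟨(k, m - k), by simp only [Prod.mk.injEq]; omega⟩
    · exact Or.inr ⟨(k + 1, m - k - 1), by simp only [Prod.mk.injEq]; omega⟩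

/-- The substitution m = k + l, n = k - l (or k - l - 1) diagonalizes m² + n² and separates x from
y. The product thereby becomes a 2 × 2 determinant in second order theta functions. -/
theorem oddTheta_mul {σ : ℂ} (hσ : 0 < σ.im) (x y : ℂ) :
    Complex.exp (Real.pi * Complex.I * σ / 2) * (oddTheta (x + y) σ * oddTheta (x - y) σ) =
      halfTheta x σ * evenTheta y σ - evenTheta x σ * halfTheta y σ := by
  have h2σ : 0 < (2 * σ).im := by simpa using hσ
  have key : HasSum (fun k : ℤ × ℤ ↦ Complex.exp (Real.pi * Complex.I * σ / 2) *
      (Complex.exp (Real.pi * Complex.I * (x + y)) * Complex.exp (Real.pi * Complex.I * (x - y))) *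
      (jacobiTheta₂_term k.1 (x + y + (1 + σ) / 2) σ *
        jacobiTheta₂_term k.2 (x - y + (1 + σ) / 2) σ)) _ :=
    (hasSum_jacobiTheta₂_mul (x + y + (1 + σ) / 2) (x - y + (1 + σ) / 2) hσ hσ).mul_left _
  have ha := (hasSum_jacobiTheta₂_mul (2 * x + σ) (2 * y) h2σ h2σ).mul_left
    (Complex.exp (2 * Real.pi * Complex.I * x + Real.pi * Complex.I * σ / 2))
  have hb := (hasSum_jacobiTheta₂_mul (2 * x) (2 * y + σ) h2σ h2σ).mul_left
    (-Complex.exp (2 * Real.pi * Complex.I * y + Real.pi * Complex.I * σ / 2))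
  have ea : (fun k : ℤ × ℤ ↦ Complex.exp (Real.pi * Complex.I * σ / 2) *
      (Complex.exp (Real.pi * Complex.I * (x + y)) * Complex.exp (Real.pi * Complex.I * (x - y))) *
      (jacobiTheta₂_term (k.1 + k.2) (x + y + (1 + σ) / 2) σ *
        jacobiTheta₂_term (k.1 - k.2) (x - y + (1 + σ) / 2) σ)) =
      fun k ↦ Complex.exp (2 * Real.pi * Complex.I * x + Real.pi * Complex.I * σ / 2) *
        (jacobiTheta₂_term k.1 (2 * x + σ) (2 * σ) * jacobiTheta₂_term k.2 (2 * y) (2 * σ)) := by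
    funext ⟨k, l⟩
    simp only [jacobiTheta₂_term, ← Complex.exp_add]
    refine Complex.exp_eq_exp_iff_exists_int.mpr ⟨k, ?_⟩
    push_cast
    ring
  have eb : (fun k : ℤ × ℤ ↦ Complex.exp (Real.pi * Complex.I * σ / 2) *
      (Complex.exp (Real.pi * Complex.I * (x + y)) * Complex.exp (Real.pi * Complex.I * (x - y))) *
      (jacobiTheta₂_term (k.1 + k.2) (x + y + (1 + σ) / 2) σ *
        jacobiTheta₂_term (k.1 - k.2 - 1) (x - y + (1 + σ) / 2) σ)) =
      fun k ↦ -Complex.exp (2 * Real.pi * Complex.I * y + Real.pi * Complex.I * σ / 2) *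
        (jacobiTheta₂_term k.1 (2 * x) (2 * σ) * jacobiTheta₂_term k.2 (2 * y + σ) (2 * σ)) := by
    funext ⟨k, l⟩
    rw [neg_mul, ← neg_one_mul, ← Complex.exp_pi_mul_I]
    simp only [jacobiTheta₂_term, ← Complex.exp_add]
    -- The two shifts by 1/2 contribute 2πi(k - 1/2), and the sign written as exp(πi) takes away
    -- another πi.
    refine Complex.exp_eq_exp_iff_exists_int.mpr ⟨k - 1, ?_⟩
    push_cast
    ring
  have := key.unique (hasSum_of_parity (ea ▸ ha) (eb ▸ hb))
  simp only [oddTheta, halfTheta, evenTheta]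
  linear_combination this

/-- The three-term relation of Weierstrass. -/
theorem oddTheta_three_term {σ : ℂ} (hσ : 0 < σ.im) (x y z w : ℂ) :
    oddTheta (x + y) σ * oddTheta (x - y) σ * (oddTheta (z + w) σ * oddTheta (z - w) σ) -
      oddTheta (x + z) σ * oddTheta (x - z) σ * (oddTheta (y + w) σ * oddTheta (y - w) σ) +
      oddTheta (x + w) σ * oddTheta (x - w) σ * (oddTheta (y + z) σ * oddTheta (y - z) σ) = 0 := by
  have hE : Complex.exp (Real.pi * Complex.I * σ / 2) ≠ 0 := Complex.exp_ne_zero _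
  have h (a b : ℂ) : oddTheta (a + b) σ * oddTheta (a - b) σ =
      (halfTheta a σ * evenTheta b σ - evenTheta a σ * halfTheta b σ) /
        Complex.exp (Real.pi * Complex.I * σ / 2) := by
    rw [eq_div_iff hE, mul_comm, oddTheta_mul hσ]
  -- Each product is a 2 × 2 minor of the matrix with rows `halfTheta` and `evenTheta`; the identity
  -- is the Plücker relation among these minors.
  rw [h, h, h, h, h, h]
  ring

/-- The elliptic function `θ'(0) θ(3u)² / (θ(u)² θ(4u))`. -/
def thetaQuot (u σ : ℂ) : ℂ :=
  deriv (fun z ↦ oddTheta z σ) 0 * oddTheta (3 * u) σ ^ 2 /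
    (oddTheta u σ ^ 2 * oddTheta (4 * u) σ)

/-- The three-term relation at (3u, 0, u, w) holds identically in w. Its derivative at w = u,
divided by θ(u)²θ(2u)θ(4u), is the claim; θ'(0) appears because θ(u - w) vanishes at w = u. -/
theorem logDeriv_add_eq_thetaQuot {σ u : ℂ} (hσ : 0 < σ.im) (h1 : oddTheta u σ ≠ 0)
    (h2 : oddTheta (2 * u) σ ≠ 0) (h4 : oddTheta (4 * u) σ ≠ 0) :
    2 * logDeriv (fun z ↦ oddTheta z σ) u + logDeriv (fun z ↦ oddTheta z σ) (2 * u) -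
      logDeriv (fun z ↦ oddTheta z σ) (4 * u) = thetaQuot u σ := by
  set f := fun z ↦ oddTheta z σ with hf
  have hd (z : ℂ) : HasDerivAt f (deriv f z) z := (differentiable_oddTheta hσ z).hasDerivAt
  have g1 : HasDerivAt (fun w ↦ f (u + w)) (deriv f (2 * u)) u := by
    refine HasDerivAt.comp_const_add u u ?_
    rw [← two_mul]; exact hd _
  have g2 : HasDerivAt (fun w ↦ f (u - w)) (-deriv f 0) u := by
    refine HasDerivAt.comp_const_sub u u ?_
    rw [sub_self]; exact hd _
  have g3 : HasDerivAt (fun w ↦ f (3 * u + w)) (deriv f (4 * u)) u := by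
    refine HasDerivAt.comp_const_add (3 * u) u ?_
    rw [show 3 * u + u = 4 * u by ring]; exact hd _
  have g4 : HasDerivAt (fun w ↦ f (3 * u - w)) (-deriv f (2 * u)) u := by
    refine HasDerivAt.comp_const_sub (3 * u) u ?_
    rw [show 3 * u - u = 2 * u by ring]; exact hd _
  have G := (((g1.fun_mul g2).const_mul (f (3 * u) ^ 2)).fun_add
    (((hd u).fun_pow 2).const_mul (f (4 * u) * f (2 * u)))).fun_sub
    ((g3.fun_mul g4).mul_const (f u ^ 2))
  have Z : (fun w ↦ f (3 * u) ^ 2 * (f (u + w) * f (u - w)) + f (4 * u) * f (2 * u) * f w ^ 2 -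
      f (3 * u + w) * f (3 * u - w) * f u ^ 2) = fun _ ↦ 0 := by
    funext w
    have := oddTheta_three_term hσ (3 * u) 0 u w
    rw [add_zero, sub_zero, show 3 * u + u = 4 * u by ring, show 3 * u - u = 2 * u by ring,
      zero_add, zero_add, zero_sub, zero_sub, oddTheta_neg, oddTheta_neg] at this
    linear_combination this
  rw [Z] at G
  have E := G.unique (hasDerivAt_const u (0 : ℂ))
  simp only [sub_self, show 3 * u + u = 4 * u by ring, show 3 * u - u = 2 * u by ring,
    ← two_mul u, show f 0 = 0 from oddTheta_zero σ] at E
  have h1' : f u ≠ 0 := h1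
  have h2' : f (2 * u) ≠ 0 := h2
  have h4' : f (4 * u) ≠ 0 := h4
  simp only [logDeriv_apply, thetaQuot]
  change _ = deriv f 0 * f (3 * u) ^ 2 / (f u ^ 2 * f (4 * u))
  generalize f u = a at h1' E ⊢
  generalize f (2 * u) = b at h2' E ⊢
  generalize f (4 * u) = c at h4' E ⊢
  generalize f (3 * u) = d at E ⊢
  generalize deriv f (2 * u) = b' at E ⊢
  generalize deriv f (4 * u) = c' at E ⊢
  field_simp
  linear_combination E

/-! ### Periods and modularity of the theta quotient -/

theorem thetaQuot_add_int (u σ : ℂ) (n : ℤ) : thetaQuot (u + n) σ = thetaQuot u σ := by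
  have e : ((-1 : ℂ) ^ n) ^ 2 = 1 := by rw [← zpow_natCast, ← zpow_mul, mul_comm, zpow_mul]; norm_num
  have e3 : (-1 : ℂ) ^ (3 * n) = (-1) ^ n := by
    rw [zpow_mul]; norm_num
  have e4 : (-1 : ℂ) ^ (4 * n) = 1 := by
    rw [zpow_mul]; norm_num
  have t3 : 3 * (u + n) = 3 * u + (3 * n : ℤ) := by push_cast; ring
  have t4 : 4 * (u + n) = 4 * u + (4 * n : ℤ) := by push_cast; ring
  simp only [thetaQuot]
  rw [t3, t4, oddTheta_add_int, oddTheta_add_int, oddTheta_add_int, mul_pow, mul_pow, e3, e4, e,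
    one_mul, one_mul, one_mul]

theorem thetaQuot_add_int_mul (u σ : ℂ) (n : ℤ) : thetaQuot (u + n * σ) σ = thetaQuot u σ := by
  have e : ((-1 : ℂ) ^ n) ^ 2 = 1 := by rw [← zpow_natCast, ← zpow_mul, mul_comm, zpow_mul]; norm_num
  have e3 : (-1 : ℂ) ^ (3 * n) = (-1) ^ n := by
    rw [zpow_mul]; norm_num
  have e4 : (-1 : ℂ) ^ (4 * n) = 1 := by
    rw [zpow_mul]; norm_num
  have t3 : 3 * (u + n * σ) = 3 * u + (3 * n : ℤ) * σ := by push_cast; ring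
  have t4 : 4 * (u + n * σ) = 4 * u + (4 * n : ℤ) * σ := by push_cast; ring
  simp only [thetaQuot]
  rw [t3, t4, oddTheta_add_int_mul, oddTheta_add_int_mul, oddTheta_add_int_mul, e3, e4]
  set X := Complex.exp (-(Real.pi * Complex.I * (n ^ 2 * σ + 2 * n * u))) with hX
  -- The automorphy factor of θ(mu) is the m²-th power of that of θ(u), and 2·9 = 2·1 + 16, so
  -- numerator and denominator balance.
  have x3 : Complex.exp (-(Real.pi * Complex.I * ((3 * n : ℤ) ^ 2 * σ + 2 * (3 * n : ℤ) * (3 * u))))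
      = X ^ 9 := by
    rw [hX, ← Complex.exp_nat_mul]; congr 1; push_cast; ring
  have x4 : Complex.exp (-(Real.pi * Complex.I * ((4 * n : ℤ) ^ 2 * σ + 2 * (4 * n : ℤ) * (4 * u))))
      = X ^ 16 := by
    rw [hX, ← Complex.exp_nat_mul]; congr 1; push_cast; ring
  rw [x3, x4]
  have hX0 : X ≠ 0 := Complex.exp_ne_zero _
  simp only [mul_pow, e, one_mul]
  rw [show deriv (fun z ↦ oddTheta z σ) 0 * ((X ^ 9) ^ 2 * oddTheta (3 * u) σ ^ 2) =
      X ^ 18 * (deriv (fun z ↦ oddTheta z σ) 0 * oddTheta (3 * u) σ ^ 2) by ring,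
    show X ^ 2 * oddTheta u σ ^ 2 * (X ^ 16 * oddTheta (4 * u) σ) =
      X ^ 18 * (oddTheta u σ ^ 2 * oddTheta (4 * u) σ) by ring,
    mul_div_mul_left _ _ (pow_ne_zero 18 hX0)]

/-- In this normalization σ enters only through πi(n² + n)σ with n² + n even, so no root of unity
appears. -/
theorem oddTheta_add_one_right (z σ : ℂ) : oddTheta z (σ + 1) = oddTheta z σ := by
  simp only [oddTheta, jacobiTheta₂]
  congr 1
  refine tsum_congr fun n ↦ ?_
  obtain ⟨k, hk⟩ := Int.even_mul_succ_self n
  have hk' : (n : ℂ) * (n + 1) = k + k := mod_cast hk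
  have e : 2 * Real.pi * Complex.I * n * (z + (1 + (σ + 1)) / 2) +
      Real.pi * Complex.I * n ^ 2 * (σ + 1) =
      2 * Real.pi * Complex.I * n * (z + (1 + σ) / 2) + Real.pi * Complex.I * n ^ 2 * σ +
        k * (2 * Real.pi * Complex.I) := by
    linear_combination (Real.pi * Complex.I) * hk'
  rw [jacobiTheta₂_term, jacobiTheta₂_term, e, Complex.exp_add _ (k * _),
    Complex.exp_int_mul_two_pi_mul_I, mul_one]

/-- All that matters about κ is that it is non-zero and independent of z: `thetaQuot` has three
theta factors above (one differentiated) and three below, so κ cancels. -/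
theorem exists_oddTheta_inversion {σ : ℂ} (hσ : 0 < σ.im) :
    ∃ κ : ℂ, κ ≠ 0 ∧ ∀ z, oddTheta (z / σ) (-1 / σ) =
      κ * Complex.exp (Real.pi * Complex.I * z ^ 2 / σ) * oddTheta z σ := by
  have hσ0 : σ ≠ 0 := by rintro rfl; simp at hσ
  have hs : (-Complex.I * σ) ^ (1 / 2 : ℂ) ≠ 0 := by
    rw [Complex.cpow_ne_zero_iff_of_exponent_ne_zero (by norm_num)]
    exact mul_ne_zero (neg_ne_zero.mpr Complex.I_ne_zero) hσ0
  refine ⟨-((-Complex.I * σ) ^ (1 / 2 : ℂ)) *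
    Complex.exp (Real.pi * Complex.I * (1 + σ) ^ 2 / (4 * σ)),
    mul_ne_zero (neg_ne_zero.mpr hs) (Complex.exp_ne_zero _), fun z ↦ ?_⟩
  have h1 := jacobiTheta₂_functional_equation (z + (1 + σ) / 2) σ
  have h2 := jacobiTheta₂_add_left' ((z + (1 + σ) / 2) / σ) (-1 / σ)
  rw [show (z + (1 + σ) / 2) / σ + -1 / σ = z / σ + (1 + -1 / σ) / 2 by field_simp; ring] at h2
  rw [oddTheta, oddTheta, h2, h1]
  have e : Complex.exp (Real.pi * Complex.I * (z / σ)) *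
      Complex.exp (-Real.pi * Complex.I * (-1 / σ + 2 * ((z + (1 + σ) / 2) / σ))) =
      -(Complex.exp (Real.pi * Complex.I * (1 + σ) ^ 2 / (4 * σ)) *
      Complex.exp (Real.pi * Complex.I * z ^ 2 / σ) * (Complex.exp (Real.pi * Complex.I * z) *
      Complex.exp (-Real.pi * Complex.I * (z + (1 + σ) / 2) ^ 2 / σ))) := by
    have (X : ℂ) : -X = Complex.exp (-(Real.pi * Complex.I)) * X := by
      rw [Complex.exp_neg, Complex.exp_pi_mul_I]; norm_num
    rw [this (_ * _ * (_ * _))]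
    simp only [← Complex.exp_add]
    congr 1
    field_simp
    ring
  rw [← mul_assoc, e]
  field_simp

theorem thetaQuot_inversion {σ : ℂ} (hσ : 0 < σ.im) (u : ℂ) :
    thetaQuot (u / σ) (-1 / σ) = σ * thetaQuot u σ := by
  have hσ0 : σ ≠ 0 := by rintro rfl; simp at hσ
  have hσ' : 0 < (-1 / σ).im := by
    have := (ModularGroup.S • (⟨σ, hσ⟩ : ℍ)).im_pos
    rw [modular_S_smul] at this
    simpa [neg_div, div_eq_mul_inv] using this
  obtain ⟨κ, hκ, h⟩ := exists_oddTheta_inversion hσ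
  have d1 : HasDerivAt (fun z ↦ oddTheta (z / σ) (-1 / σ))
      (deriv (fun z ↦ oddTheta z (-1 / σ)) 0 * (1 / σ)) 0 := by
    have := (differentiable_oddTheta hσ' (0 / σ)).hasDerivAt.comp (0 : ℂ)
      ((hasDerivAt_id (0 : ℂ)).div_const σ)
    rwa [zero_div] at this
  have d2 : HasDerivAt (fun z ↦ κ * Complex.exp (Real.pi * Complex.I * z ^ 2 / σ) * oddTheta z σ)
      (κ * deriv (fun z ↦ oddTheta z σ) 0) 0 := by
    have e : DifferentiableAt ℂ
      (fun z ↦ κ * Complex.exp (Real.pi * Complex.I * z ^ 2 / σ)) 0 := by fun_prop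
    have := e.hasDerivAt.fun_mul (differentiable_oddTheta hσ 0).hasDerivAt
    simpa [oddTheta_zero] using this
  have D : deriv (fun z ↦ oddTheta z (-1 / σ)) 0 = σ * κ * deriv (fun z ↦ oddTheta z σ) 0 := by
    have := d1.unique ((funext h : (fun z ↦ oddTheta (z / σ) (-1 / σ)) = _) ▸ d2)
    rw [mul_one_div, div_eq_iff hσ0] at this
    linear_combination this
  simp only [thetaQuot]
  rw [D, ← mul_div_assoc, ← mul_div_assoc, h, h, h]
  set X := Complex.exp (Real.pi * Complex.I * u ^ 2 / σ) with hX
  have x3 : Complex.exp (Real.pi * Complex.I * (3 * u) ^ 2 / σ) = X ^ 9 := by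
    rw [hX, ← Complex.exp_nat_mul]; congr 1; push_cast; ring
  have x4 : Complex.exp (Real.pi * Complex.I * (4 * u) ^ 2 / σ) = X ^ 16 := by
    rw [hX, ← Complex.exp_nat_mul]; congr 1; push_cast; ring
  have hX0 : X ≠ 0 := Complex.exp_ne_zero _
  rw [x3, x4, show σ * κ * deriv (fun z ↦ oddTheta z σ) 0 *
      (κ * X ^ 9 * oddTheta (3 * u) σ) ^ 2 = κ ^ 3 * X ^ 18 *
        (σ * (deriv (fun z ↦ oddTheta z σ) 0 * oddTheta (3 * u) σ ^ 2)) by ring,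
    show (κ * X * oddTheta u σ) ^ 2 * (κ * X ^ 16 * oddTheta (4 * u) σ) =
      κ ^ 3 * X ^ 18 * (oddTheta u σ ^ 2 * oddTheta (4 * u) σ) by ring,
    mul_div_mul_left _ _ (mul_ne_zero (pow_ne_zero 3 hκ) (pow_ne_zero 18 hX0)), mul_div_assoc]

theorem specialLinear_smul_coe (γ : SL(2, ℤ)) (τ : ℍ) :
    ((γ • τ : ℍ) : ℂ) = (γ 0 0 * τ + γ 0 1) / (γ 1 0 * τ + γ 1 1) := by
  rw [UpperHalfPlane.specialLinearGroup_apply]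
  simp

theorem specialLinear_denom_ne_zero (γ : SL(2, ℤ)) (τ : ℍ) :
    (γ 1 0 * τ + γ 1 1 : ℂ) ≠ 0 := by
  have := UpperHalfPlane.denom_ne_zero γ τ
  rwa [ModularGroup.denom_apply] at this

/-- By the cocycle property of cτ + d it suffices to treat the generators S and T, which are
inversion and σ ↦ σ + 1. -/
theorem thetaQuot_modular (γ : SL(2, ℤ)) (u : ℂ) (τ : ℍ) :
    thetaQuot (u / (γ 1 0 * τ + γ 1 1)) (γ • τ : ℍ) = (γ 1 0 * τ + γ 1 1) * thetaQuot u τ := by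
  have hγ : γ ∈ Subgroup.closure {ModularGroup.S, ModularGroup.T} := by
    simp [SpecialLinearGroup.SL2Z_generators]
  have cocycle (g h : SL(2, ℤ)) (τ : ℍ) : (((g * h) 1 0 : ℤ) * τ + ((g * h) 1 1 : ℤ) : ℂ) =
      (g 1 0 * (h • τ : ℍ) + g 1 1) * (h 1 0 * τ + h 1 1) := by
    have := specialLinear_denom_ne_zero h τ
    rw [specialLinear_smul_coe, Matrix.SpecialLinearGroup.coe_mul]
    simp only [Matrix.mul_apply, Fin.sum_univ_two]
    push_cast
    field_simp
    ring
  induction hγ using Subgroup.closure_induction generalizing u τ with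
  | one => simp
  | mem g hg =>
    rcases hg with rfl | rfl
    · have := thetaQuot_inversion τ.im_pos u
      rw [specialLinear_smul_coe]
      simpa [ModularGroup.S, neg_div] using this
    · have : thetaQuot u ((τ : ℂ) + 1) = thetaQuot u τ := by
        simp only [thetaQuot, oddTheta_add_one_right]
      rw [specialLinear_smul_coe]
      simpa [ModularGroup.T] using this
  | mul g h _ _ ig ih =>
    rw [cocycle, mul_comm (_ + _ : ℂ), ← div_div, mul_smul, ig, ih]
    ring
  | inv g _ ig =>
    have h1 := cocycle g g⁻¹ τ
    rw [mul_inv_cancel] at h1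
    have h1' : (1 : ℂ) = (g 1 0 * (g⁻¹ • τ : ℍ) + g 1 1) * (g⁻¹ 1 0 * τ + g⁻¹ 1 1) := by
      simpa using h1
    have h2 := ig (u / (g⁻¹ 1 0 * τ + g⁻¹ 1 1)) (g⁻¹ • τ)
    rw [div_div, mul_comm (_ + _ : ℂ) (g 1 0 * _ + _), ← h1', div_one, smul_inv_smul] at h2
    rw [h2, ← mul_assoc, mul_comm (_ + _ : ℂ) (g 1 0 * _ + _), ← h1', one_mul]

/-! ### Values of L-functions at zero -/

theorem norm_cpow_sub_cpow_le {a x : ℝ} (ha : 0 < a) (hx : x ∈ Set.Icc a (a + 1)) {c : ℂ}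
    (hc : c.re ≤ 1) : ‖(x : ℂ) ^ c - (a : ℂ) ^ c‖ ≤ ‖c‖ * a ^ (c.re - 1) := by
  have hd : ∀ y ∈ Set.Icc a (a + 1), HasDerivWithinAt (fun y : ℝ ↦ (y : ℂ) ^ c)
      (c * (y : ℂ) ^ (c - 1)) (Set.Icc a (a + 1)) y := by
    intro y hy
    have hy0 : 0 < y := ha.trans_le hy.1
    have := ((hasDerivAt_id' (y : ℂ)).cpow_const (c := c) (Or.inl (by simpa using hy0))).comp_ofReal
    simpa using this.hasDerivWithinAt
  have hb : ∀ y ∈ Set.Icc a (a + 1), ‖c * (y : ℂ) ^ (c - 1)‖ ≤ ‖c‖ * a ^ (c.re - 1) := by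
    intro y hy
    have hy0 : 0 < y := ha.trans_le hy.1
    rw [norm_mul, Complex.norm_cpow_eq_rpow_re_of_pos hy0]
    refine mul_le_mul_of_nonneg_left ?_ (norm_nonneg _)
    exact Real.rpow_le_rpow_of_nonpos ha hy.1 (by simpa using hc)
  have h := (convex_Icc a (a + 1)).norm_image_sub_le_of_norm_hasDerivWithin_le hd hb
    (Set.left_mem_Icc.mpr (by linarith)) hx
  refine h.trans (mul_le_of_le_one_right (by positivity) ?_)
  rw [Real.norm_eq_abs, abs_le]
  constructor <;> linarith [hx.1, hx.2]

/-- The error term in the comparison of `n ^ (-s) - (n + 1) ^ (-s)` with its first order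
approximation. -/
def stepError (n : ℕ) (s : ℂ) : ℂ :=
  ((n + 1 : ℕ) : ℂ) ^ (-s) - ((n + 2 : ℕ) : ℂ) ^ (-s) - s * ((n + 1 : ℕ) : ℂ) ^ (-(s + 1))

/-- A second order mean value estimate. The extra power of n gained is what makes the series of
errors converge to the left of Re s = 0. -/
theorem norm_stepError_le (n : ℕ) {s : ℂ} (hs : -2 ≤ s.re) :
    ‖stepError n s‖ ≤ ‖s‖ * (‖s + 1‖ * ((n : ℝ) + 1) ^ (-s.re - 2)) := by
  set a : ℝ := n + 1 with ha
  have ha0 : 0 < a := by positivity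
  have hd : ∀ y ∈ Set.Icc a (a + 1), HasDerivWithinAt
      (fun y : ℝ ↦ -(y : ℂ) ^ (-s) - s * (a : ℂ) ^ (-(s + 1)) * y)
      (s * ((y : ℂ) ^ (-(s + 1)) - (a : ℂ) ^ (-(s + 1)))) (Set.Icc a (a + 1)) y := by
    intro y hy
    have hy0 : 0 < y := ha0.trans_le hy.1
    have h1 := ((hasDerivAt_id' (y : ℂ)).cpow_const (c := -s)
      (Or.inl (by simpa using hy0))).comp_ofReal
    have h2 := (((hasDerivAt_id' (y : ℂ)).const_mul (s * (a : ℂ) ^ (-(s + 1))))).comp_ofReal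
    have h3 := (h1.fun_neg.fun_sub h2).hasDerivWithinAt (s := Set.Icc a (a + 1))
    refine h3.congr_deriv ?_
    rw [show -s - 1 = -(s + 1) by ring]
    ring
  have hb : ∀ y ∈ Set.Icc a (a + 1), ‖s * ((y : ℂ) ^ (-(s + 1)) - (a : ℂ) ^ (-(s + 1)))‖ ≤
      ‖s‖ * (‖s + 1‖ * a ^ (-s.re - 2)) := by
    intro y hy
    rw [norm_mul]
    refine mul_le_mul_of_nonneg_left ?_ (norm_nonneg _)
    refine (norm_cpow_sub_cpow_le ha0 hy (by simp; linarith)).trans_eq ?_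
    rw [norm_neg]
    congr 2
    simp
    ring
  have h := (convex_Icc a (a + 1)).norm_image_sub_le_of_norm_hasDerivWithin_le hd hb
    (Set.left_mem_Icc.mpr (by linarith)) (Set.right_mem_Icc.mpr (by linarith))
  rw [add_sub_cancel_left, norm_one, mul_one] at h
  refine le_trans (le_of_eq ?_) h
  rw [stepError]
  congr 1
  simp only [ha]
  push_cast
  rw [show (n : ℂ) + 1 + 1 = n + 2 by ring]
  ring

section LValue

variable {N : ℕ} [NeZero N] {Φ S : ZMod N → ℂ}

theorem norm_le_sum_norm (S : ZMod N → ℂ) (j : ZMod N) : ‖S j‖ ≤ ∑ i, ‖S i‖ :=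
  Finset.single_le_sum (f := fun i ↦ ‖S i‖) (fun _ _ ↦ norm_nonneg _) (Finset.mem_univ j)

theorem hasSum_LFunction (Φ : ZMod N → ℂ) {s : ℂ} (hs : 1 < s.re) :
    HasSum (fun n : ℕ ↦ Φ ((n + 1 : ℕ) : ZMod N) * ((n + 1 : ℕ) : ℂ) ^ (-s))
      (ZMod.LFunction Φ s) := by
  have h := (ZMod.LSeriesSummable_of_one_lt_re Φ hs).hasSum
  rw [ZMod.LFunction_eq_LSeries Φ hs, LSeries]
  rw [← hasSum_nat_add_iff' 1] at h
  simp only [Finset.range_one, Finset.sum_singleton, LSeries.term_zero, sub_zero] at h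
  refine (congrArg (fun f ↦ HasSum f _) (funext fun n ↦ ?_)).mpr h
  rw [LSeries.term_of_ne_zero (Nat.succ_ne_zero n), Complex.cpow_neg, div_eq_mul_inv]

/-- Abel summation; S 0 = 0 removes the boundary term. -/
theorem LFunction_sub_eq_tsum_stepError (hΦ : ∀ j, Φ j = S j - S (j - 1)) (h0 : S 0 = 0)
    {s : ℂ} (hs : 1 < s.re) :
    ZMod.LFunction Φ s - s * ZMod.LFunction S (s + 1) =
      ∑' n : ℕ, S ((n + 1 : ℕ) : ZMod N) * stepError n s := by
  have h1 := hasSum_LFunction S hs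
  have h2 := hasSum_LFunction (fun j ↦ S (j - 1)) hs
  have h3 := (hasSum_LFunction S (s := s + 1) (by simp; linarith)).mul_left s
  rw [← hasSum_nat_add_iff' 1] at h2
  simp only [Finset.range_one, Finset.sum_singleton, zero_add, Nat.cast_one, sub_self, h0, zero_mul,
    sub_zero] at h2
  have h4 : ZMod.LFunction Φ s = ZMod.LFunction S s - ZMod.LFunction (fun j ↦ S (j - 1)) s := by
    refine (hasSum_LFunction Φ hs).unique
      ((congrArg (fun f ↦ HasSum f _) (funext fun n ↦ ?_)).mpr
        (h1.sub (hasSum_LFunction (fun j ↦ S (j - 1)) hs)))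
    rw [hΦ]
    ring
  rw [h4]
  refine (HasSum.tsum_eq ((congrArg (fun f ↦ HasSum f _) (funext fun n ↦ ?_)).mpr
    ((h1.sub h2).sub h3))).symm
  rw [stepError]
  push_cast
  rw [show (n : ZMod N) + 1 + 1 - 1 = n + 1 by ring, show (n : ℂ) + 1 + 1 = n + 2 by ring]
  ring

/-- The value at zero of the L-function of a periodic function that is the difference of a
periodic function vanishing at zero. -/
theorem LFunction_zero_eq (hΦ : ∀ j, Φ j = S j - S (j - 1)) (h0 : S 0 = 0) :
    ZMod.LFunction Φ 0 = (∑ j, S j) / N := by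
  -- On U the errors are dominated by a multiple of n^(-3/2), so their sum K is holomorphic across s
  -- = 0. The smaller set V avoids the possible pole of s ↦ L(S, s + 1) at 0.
  set U : Set ℂ := {s | -(1 / 2) < s.re} ∩ Metric.ball 0 4 with hU
  have hUo : IsOpen U :=
    (isOpen_lt continuous_const Complex.continuous_re).inter Metric.isOpen_ball
  set V : Set ℂ := {s | 0 < s.re} ∩ Metric.ball 0 4 with hV
  have hVo : IsOpen V :=
    (isOpen_lt continuous_const Complex.continuous_re).inter Metric.isOpen_ball
  have hVU : V ⊆ U := fun s hs ↦
    ⟨lt_trans (show (-(1 / 2) : ℝ) < 0 by norm_num) (show 0 < s.re from hs.1), hs.2⟩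
  have hVc : IsPreconnected V :=
    ((convex_halfSpace_re_gt 0).inter (convex_ball _ _)).isPreconnected
  set K : ℂ → ℂ := fun s ↦ ∑' n : ℕ, S ((n + 1 : ℕ) : ZMod N) * stepError n s with hK
  have hKd : DifferentiableOn ℂ K U := by
    refine Complex.differentiableOn_tsum_of_summable_norm
      (u := fun n : ℕ ↦ (∑ i, ‖S i‖) * (4 * (5 * ((n : ℝ) + 1) ^ (-(3 / 2) : ℝ)))) ?_ ?_ hUo ?_
    · have := (summable_nat_add_iff 1).mpr (Real.summable_nat_rpow.mpr
        (show (-(3 / 2) : ℝ) < -1 by norm_num))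
      push_cast at this
      exact ((this.mul_left 5).mul_left 4).mul_left _
    · intro n s _
      have e1 : ((n + 1 : ℕ) : ℂ) ≠ 0 := Nat.cast_ne_zero.mpr (Nat.succ_ne_zero n)
      have e2 : ((n + 2 : ℕ) : ℂ) ≠ 0 := Nat.cast_ne_zero.mpr (Nat.succ_ne_zero (n + 1))
      refine DifferentiableAt.differentiableWithinAt ?_
      unfold stepError
      have d1 : DifferentiableAt ℂ (fun s : ℂ ↦ -s) s := by fun_prop
      have d2 : DifferentiableAt ℂ (fun s : ℂ ↦ -(s + 1)) s := by fun_prop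
      exact (((d1.const_cpow (Or.inl e1)).sub (d1.const_cpow (Or.inl e2))).sub
        (differentiableAt_id.mul (d2.const_cpow (Or.inl e1)))).const_mul _
    · intro n s hs
      have hs1 : -(1 / 2) < s.re := hs.1
      have hs2 : ‖s‖ < 4 := mem_ball_zero_iff.mp hs.2
      have hs3 : ‖s + 1‖ ≤ 5 := (norm_add_le _ _).trans (by rw [norm_one]; linarith)
      rw [norm_mul]
      gcongr
      · exact norm_le_sum_norm S _
      · refine (norm_stepError_le n (by linarith)).trans ?_
        gcongr
        · simp
        · linarith
  have hDd : DifferentiableOn ℂ (fun s ↦ ZMod.LFunction Φ s - s * ZMod.LFunction S (s + 1)) V := by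
    intro s hs
    refine DifferentiableAt.differentiableWithinAt ?_
    have hΦs : ∑ j, Φ j = 0 := by
      simp_rw [hΦ, Finset.sum_sub_distrib]
      rw [sub_eq_zero]
      exact (Equiv.sum_comp (Equiv.subRight (1 : ZMod N)) S).symm
    have h1 : s + 1 ≠ 1 := by
      intro h
      have hs1 : 0 < s.re := hs.1
      rw [add_eq_right.mp h] at hs1
      simp at hs1
    exact (ZMod.differentiableAt_LFunction Φ s (Or.inr hΦs)).sub (differentiableAt_id.mul
      (DifferentiableAt.comp s (f := fun s : ℂ ↦ s + 1)
        (ZMod.differentiableAt_LFunction S (s + 1) (Or.inl h1)) (by fun_prop)))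
  -- The identity theorem carries the Abel summation formula from Re s > 1 to V. Then s → 0⁺: K
  -- tends to K(0) = 0, and s·L(S, s + 1) tends to the residue, which is the mean of S.
  have heq : Set.EqOn (fun s ↦ ZMod.LFunction Φ s - s * ZMod.LFunction S (s + 1)) K V := by
    refine (hDd.analyticOnNhd hVo).eqOn_of_preconnected_of_eventuallyEq
      ((hKd.mono hVU).analyticOnNhd hVo) hVc (z₀ := 2) (by norm_num [hV]) ?_
    filter_upwards [(isOpen_lt continuous_const Complex.continuous_re).mem_nhds
      (show (2 : ℂ) ∈ {s : ℂ | 1 < s.re} by simp)] with s hs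
    exact LFunction_sub_eq_tsum_stepError hΦ h0 hs
  have t0 : Tendsto (fun x : ℝ ↦ (x : ℂ)) (𝓝[>] 0) (𝓝 0) := by
    have : Tendsto (fun x : ℝ ↦ (x : ℂ)) (𝓝 0) (𝓝 0) := by
      simpa using (Complex.continuous_ofReal.tendsto 0)
    exact this.mono_left nhdsWithin_le_nhds
  have l1 : Tendsto (fun x : ℝ ↦ ZMod.LFunction Φ x) (𝓝[>] 0) (𝓝 (ZMod.LFunction Φ 0)) :=
    (ZMod.differentiableAt_LFunction Φ 0 (Or.inl zero_ne_one)).continuousAt.tendsto.comp t0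
  have l2 : Tendsto (fun x : ℝ ↦ (x : ℂ) * ZMod.LFunction S (x + 1)) (𝓝[>] 0)
      (𝓝 ((∑ j, S j) / N)) := by
    have t1 : Tendsto (fun x : ℝ ↦ (x : ℂ) + 1) (𝓝[>] 0) (𝓝[≠] 1) := by
      refine tendsto_nhdsWithin_iff.mpr ⟨by simpa using t0.add_const 1, ?_⟩
      filter_upwards [self_mem_nhdsWithin] with x hx
      simpa using (ne_of_gt hx : x ≠ 0)
    have := (ZMod.LFunction_residue_one S).comp t1
    rw [← Finset.sum_div] at this
    simpa [Function.comp_def] using this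
  have l3 : Tendsto (fun x : ℝ ↦ K x) (𝓝[>] 0) (𝓝 0) := by
    have hK0 : K 0 = 0 := by simp [hK, stepError]
    have := ((hKd.differentiableAt (hUo.mem_nhds (show (0 : ℂ) ∈ U by
      simp [hU]))).continuousAt.tendsto.comp t0)
    rwa [hK0] at this
  have l4 : Tendsto (fun x : ℝ ↦ ZMod.LFunction Φ x - x * ZMod.LFunction S (x + 1)) (𝓝[>] 0)
      (𝓝 0) := by
    refine l3.congr' ?_
    filter_upwards [Ioo_mem_nhdsGT (show (0 : ℝ) < 1 by norm_num)] with x hx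
    refine (heq ⟨by simpa using hx.1, ?_⟩).symm
    rw [mem_ball_zero_iff, Complex.norm_real, Real.norm_eq_abs, abs_of_pos hx.1]
    linarith [hx.2]
  exact sub_eq_zero.mp (tendsto_nhds_unique (l1.sub l2) l4)

end LValue

/-! ### The level seven Eisenstein sum -/

/-- The odd function on `ZMod 7` with values `2, 1, 1` at `1, 2, 3`. -/
def levelCoeff (n : ZMod 7) : ℂ := (![0, 2, 1, 1, -1, -1, -2] : Fin 7 → ℂ) n

theorem odd_char_seven_values {χ : DirichletCharacter ℂ 7} (hχ : χ.Odd) :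
    χ 3 ^ 3 = -1 ∧ χ 2 = χ 3 ^ 2 ∧ χ 4 = -χ 3 ∧ χ 5 = -χ 3 ^ 2 ∧ χ 6 = -1 := by
  have h6 : χ 6 = -1 := by
    rw [← hχ]; congr 1
  have h3 : χ 3 ^ 3 = -1 := by rw [← map_pow, ← h6]; congr 1
  have h2 : χ 2 = χ 3 ^ 2 := by rw [← map_pow]; congr 1
  have h4 : χ 4 = -χ 3 := by
    rw [show (4 : ZMod 7) = 6 * 3 by decide, map_mul, h6]; ring
  have h5 : χ 5 = -χ 3 ^ 2 := by
    rw [show (5 : ZMod 7) = 6 * 2 by decide, map_mul, h6, h2]; ring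
  exact ⟨h3, h2, h4, h5, h6⟩

/-- The class 3 generates the units mod 7, so everything is a polynomial in χ(3) with χ(3)³ = -1.
Linearity in the values of χ is what lets orthogonality be applied afterwards. -/
theorem two_div_LFunction_zero {χ : DirichletCharacter ℂ 7} (hχ : χ.Odd) :
    2 / χ.LFunction 0 = 2 * χ 1 + χ 4 + χ 5 := by
  obtain ⟨h3, h2, h4, h5, h6⟩ := odd_char_seven_values hχ
  have h0 : χ 0 = 0 := χ.map_nonunit (by decide)
  set S : ZMod 7 → ℂ := fun j ↦ (![0, χ 1, χ 1 + χ 2, χ 1 + χ 2 + χ 3, χ 1 + χ 2 + χ 3 + χ 4,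
    χ 1 + χ 2 + χ 3 + χ 4 + χ 5, 0] : Fin 7 → ℂ) j with hS
  have hL : ZMod.LFunction χ 0 = (∑ j, S j) / (7 : ℕ) := by
    refine LFunction_zero_eq (fun j ↦ ?_) rfl
    have h1 : χ 1 = 1 := map_one χ
    fin_cases j
    · change χ 0 = 0 - 0
      rw [h0, sub_zero]
    · change χ 1 = χ 1 - 0
      ring
    · change χ 2 = χ 1 + χ 2 - χ 1
      ring
    · change χ 3 = χ 1 + χ 2 + χ 3 - (χ 1 + χ 2)
      ring
    · change χ 4 = χ 1 + χ 2 + χ 3 + χ 4 - (χ 1 + χ 2 + χ 3)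
      ring
    · change χ 5 = χ 1 + χ 2 + χ 3 + χ 4 + χ 5 - (χ 1 + χ 2 + χ 3 + χ 4)
      ring
    · change χ 6 = 0 - (χ 1 + χ 2 + χ 3 + χ 4 + χ 5)
      rw [h6, h5, h4, h2, h1]
      ring
  have hs : ∑ j, S j = 5 + χ 3 + 3 * χ 3 ^ 2 := by
    have : ∑ j, S j = 0 + χ 1 + (χ 1 + χ 2) + (χ 1 + χ 2 + χ 3) + (χ 1 + χ 2 + χ 3 + χ 4) +
      (χ 1 + χ 2 + χ 3 + χ 4 + χ 5) + 0 := Fin.sum_univ_seven _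
    rw [this, h5, h4, h2, map_one]
    ring
  -- The explicit inverse of 7·L(0,χ) modulo x³ + 1, up to the factor 14; it also shows that L(0,χ)
  -- is non-zero.
  have key : (5 + χ 3 + 3 * χ 3 ^ 2) * (2 - χ 3 - χ 3 ^ 2) = 14 := by
    linear_combination (-4 - 3 * χ 3) * h3
  have hne : 5 + χ 3 + 3 * χ 3 ^ 2 ≠ 0 := by
    intro h
    rw [h] at key
    norm_num at key
  rw [DirichletCharacter.LFunction, hL, hs, h4, h5, map_one]
  push_cast
  rw [div_div_eq_mul_div, div_eq_iff hne]
  linear_combination -key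

theorem odd_char_seven_isPrimitive {χ : DirichletCharacter ℂ 7} (hχ : χ.Odd) : χ.IsPrimitive := by
  rcases (Nat.dvd_prime (by norm_num)).mp χ.conductor_dvd_level with h | h
  · rw [← DirichletCharacter.eq_one_iff_conductor_eq_one] at h
    have h1 : χ (-1) = -1 := hχ
    rw [h, MulChar.one_apply (by decide)] at h1
    norm_num at h1
  · exact h

open Classical in
-- Projecting onto odd characters replaces χ(n) by (χ(n) - χ(-n))/2, and orthogonality over all six
-- characters finishes.
theorem sum_odd_char_seven (n : ZMod 7) :
    ∑ χ : DirichletCharacter ℂ 7 with χ.Odd, χ n =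
      (if n = 1 then 3 else 0) - (if n = -1 then 3 else 0) := by
  have h (χ : DirichletCharacter ℂ 7) : (if χ.Odd then χ n else 0) = (χ n - χ (-n)) / 2 := by
    rcases χ.even_or_odd with he | ho
    · rw [he.eval_neg, if_neg, sub_self, zero_div]
      intro ho
      have h1 : χ (-1) = 1 := he
      have h2 : χ (-1) = -1 := ho
      rw [h1] at h2
      norm_num at h2
    · rw [if_pos ho, ho.eval_neg]
      ring
  have ht : Nat.totient 7 = 6 := by decide
  rw [Finset.sum_filter, Finset.sum_congr rfl fun χ _ ↦ h χ, ← Finset.sum_div,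
    Finset.sum_sub_distrib, DirichletCharacter.sum_characters_eq,
    DirichletCharacter.sum_characters_eq, ht]
  simp only [neg_eq_iff_eq_neg]
  split_ifs <;> norm_num

theorem levelCoeff_eq_ite (n : ZMod 7) :
    2 * (((if n = 1 then 3 else 0) - (if n = -1 then 3 else 0) : ℂ)) +
      ((if 4 * n = 1 then 3 else 0) - (if 4 * n = -1 then 3 else 0)) +
      ((if 5 * n = 1 then 3 else 0) - (if 5 * n = -1 then 3 else 0)) = 3 * levelCoeff n := by
  have key : 2 * (((if n = 1 then 3 else 0) - (if n = -1 then 3 else 0) : ℤ)) +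
      ((if 4 * n = 1 then 3 else 0) - (if 4 * n = -1 then 3 else 0)) +
      ((if 5 * n = 1 then 3 else 0) - (if 5 * n = -1 then 3 else 0)) =
      3 * (![0, 2, 1, 1, -1, -1, -2] : Fin 7 → ℤ) n := by
    revert n; decide
  have h : levelCoeff n = ((![0, 2, 1, 1, -1, -1, -2] : Fin 7 → ℤ) n : ℂ) := by
    fin_cases n <;> simp [levelCoeff]
  rw [h]
  exact_mod_cast congrArg (Int.cast (R := ℂ)) key

open Classical in
theorem sum_odd_char_seven_mul (n : ZMod 7) :
    ∑ χ : DirichletCharacter ℂ 7 with χ.Odd, 2 / χ.LFunction 0 * χ n = 3 * levelCoeff n := by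
  have h : ∀ χ ∈ Finset.univ.filter fun χ : DirichletCharacter ℂ 7 ↦ χ.Odd,
      2 / χ.LFunction 0 * χ n = 2 * χ n + χ (4 * n) + χ (5 * n) := by
    intro χ hχ
    rw [two_div_LFunction_zero (Finset.mem_filter.mp hχ).2, map_mul, map_mul, map_one]
    ring
  rw [Finset.sum_congr rfl h, Finset.sum_add_distrib, Finset.sum_add_distrib, ← Finset.mul_sum,
    sum_odd_char_seven, sum_odd_char_seven, sum_odd_char_seven]
  exact levelCoeff_eq_ite n

/-- The Lambert series `∑ q ^ n / (1 - q ^ n)` over the positive integers `n` in a residue class. -/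
def lambertClass (q : ℂ) (a : ℕ) : ℂ := ∑' m : ℕ, q ^ (a + 7 * m) / (1 - q ^ (a + 7 * m))

theorem summable_lambert_nat {q : ℂ} (hq : ‖q‖ < 1) : Summable fun n : ℕ ↦ q ^ n / (1 - q ^ n) := by
  simpa using summable_norm_pow_mul_geometric_div_one_sub 0 hq

theorem norm_levelCoeff_le (n : ZMod 7) : ‖levelCoeff n‖ ≤ 2 := by
  fin_cases n <;> simp [levelCoeff]

theorem summable_levelCoeff {q : ℂ} (hq : ‖q‖ < 1) :
    Summable fun n : ℕ ↦ levelCoeff (n : ZMod 7) * (q ^ n / (1 - q ^ n)) := by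
  refine Summable.of_norm_bounded ((summable_lambert_nat hq).norm.mul_left 2) fun n ↦ ?_
  rw [norm_mul]
  gcongr
  exact norm_levelCoeff_le _

theorem tsum_levelCoeff {q : ℂ} (hq : ‖q‖ < 1) :
    ∑' n : ℕ, levelCoeff (n : ZMod 7) * (q ^ n / (1 - q ^ n)) =
      2 * lambertClass q 1 + lambertClass q 2 + lambertClass q 3 - lambertClass q 4 -
        lambertClass q 5 - 2 * lambertClass q 6 := by
  rw [Nat.sumByResidueClasses (summable_levelCoeff hq) 7]
  have h (j : ZMod 7) : ∑' m : ℕ, levelCoeff ((j.val + 7 * m : ℕ) : ZMod 7) *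
      (q ^ (j.val + 7 * m) / (1 - q ^ (j.val + 7 * m))) =
      levelCoeff j * lambertClass q j.val := by
    rw [lambertClass, ← tsum_mul_left]
    refine tsum_congr fun m ↦ ?_
    congr 2
    push_cast
    rw [ZMod.natCast_zmod_val, show (7 : ZMod 7) = 0 by decide, zero_mul, add_zero]
  simp_rw [h]
  have : ∑ j : ZMod 7, levelCoeff j * lambertClass q j.val =
    0 * lambertClass q 0 + 2 * lambertClass q 1 + 1 * lambertClass q 2 + 1 * lambertClass q 3 +
      -1 * lambertClass q 4 + -1 * lambertClass q 5 + -2 * lambertClass q 6 :=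
    Fin.sum_univ_seven _
  rw [this]
  ring

open Classical in
theorem eisensteinSum_seven (τ : ℍ) :
    eisensteinSum 7 τ = 1 +
      ∑' n : ℕ, levelCoeff (n : ZMod 7) *
        (Complex.exp (2 * Real.pi * Complex.I * τ) ^ n /
          (1 - Complex.exp (2 * Real.pi * Complex.I * τ) ^ n)) := by
  have hq : ‖Complex.exp (2 * Real.pi * Complex.I * τ)‖ < 1 := norm_exp_two_pi_I_lt_one τ
  set q := Complex.exp (2 * Real.pi * Complex.I * τ) with hqdef
  have hsum (χ : DirichletCharacter ℂ 7) :
      Summable fun n : ℕ+ ↦ 2 / χ.LFunction 0 * (χ ((n : ℕ) : ZMod 7) *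
        (q ^ (n : ℕ) / (1 - q ^ (n : ℕ)))) := by
    refine Summable.mul_left _ (Summable.of_norm_bounded
      ((summable_lambert_nat hq).norm.comp_injective PNat.coe_injective) fun n ↦ ?_)
    rw [norm_mul]
    exact mul_le_of_le_one_left (norm_nonneg _) (χ.norm_le_one _)
  have hE (χ : DirichletCharacter ℂ 7) : eisenstein 1 χ τ =
      1 + ∑' n : ℕ+, 2 / χ.LFunction 0 * (χ ((n : ℕ) : ZMod 7) *
        (q ^ (n : ℕ) / (1 - q ^ (n : ℕ)))) := by
    rw [eisenstein, tsum_mul_left]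
    simp [hqdef]
  have hset : (∑ᶠ (χ : DirichletCharacter ℂ 7) (_ : χ.Odd ∧ χ.IsPrimitive), eisenstein 1 χ τ) =
      ∑ χ : DirichletCharacter ℂ 7 with χ.Odd, eisenstein 1 χ τ := by
    rw [← finsum_mem_finset_eq_sum]
    refine finsum_congr fun χ ↦ ?_
    have : (χ.Odd ∧ χ.IsPrimitive) =
        (χ ∈ Finset.univ.filter fun χ : DirichletCharacter ℂ 7 ↦ χ.Odd) := by
      simpa using odd_char_seven_isPrimitive
    simp only [this]
  have hcard : ∑ χ : DirichletCharacter ℂ 7 with χ.Odd, (1 : ℂ) = 3 := by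
    simpa [show (1 : ZMod 7) ≠ -1 by decide] using sum_odd_char_seven 1
  rw [eisensteinSum, hset]
  simp_rw [hE]
  rw [Finset.sum_add_distrib, hcard, ← Summable.tsum_finsetSum fun χ _ ↦ hsum χ]
  have h (n : ℕ+) : ∑ χ : DirichletCharacter ℂ 7 with χ.Odd, 2 / χ.LFunction 0 *
      (χ ((n : ℕ) : ZMod 7) * (q ^ (n : ℕ) / (1 - q ^ (n : ℕ)))) =
      3 * (levelCoeff ((n : ℕ) : ZMod 7) * (q ^ (n : ℕ) / (1 - q ^ (n : ℕ)))) := by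
    simp_rw [← mul_assoc]
    rw [← Finset.sum_mul, sum_odd_char_seven_mul]
  simp_rw [h]
  rw [tsum_mul_left, tsum_pnat_eq_tsum_succ
    (f := fun n : ℕ ↦ levelCoeff (n : ZMod 7) * (q ^ n / (1 - q ^ n)))]
  rw [(summable_levelCoeff hq).tsum_eq_zero_add]
  -- The n = 0 term is harmless: its quotient 1/0 has the default value 0.
  rw [pow_zero, sub_self, div_zero, mul_zero, zero_add]
  norm_num
  ring

/-! ### Theta values at multiples of `τ` with period `7τ` -/

theorem seven_mul_im_pos (τ : ℍ) : 0 < (7 * (τ : ℂ)).im := by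
  have := τ.im_pos
  simpa using this

theorem pow_ne_one_of_norm_lt {q : ℂ} (hq : ‖q‖ < 1) {m : ℕ} (hm : m ≠ 0) : q ^ m ≠ 1 := by
  intro h
  have h1 : ‖q ^ m‖ < 1 := by
    rw [norm_pow]
    exact pow_lt_one₀ (norm_nonneg _) hq hm
  rw [h, norm_one] at h1
  exact lt_irrefl _ h1

theorem exp_seven_mul (τ : ℂ) : Complex.exp (2 * Real.pi * Complex.I * (7 * τ)) =
    Complex.exp (2 * Real.pi * Complex.I * τ) ^ 7 := by
  rw [← Complex.exp_nat_mul]; congr 1; push_cast; ring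

theorem exp_nat_mul_tau (a : ℕ) (τ : ℂ) : Complex.exp (2 * Real.pi * Complex.I * (a * τ)) =
    Complex.exp (2 * Real.pi * Complex.I * τ) ^ a := by
  rw [← Complex.exp_nat_mul]; congr 1; ring

theorem pow_seven_mul_pow (q : ℂ) (n a : ℕ) : (q ^ 7) ^ (n + 1) * q ^ a = q ^ (a + 7 * (n + 1)) := by
  rw [← pow_mul, ← pow_add, add_comm]

theorem pow_seven_mul_inv_pow {q : ℂ} (hq : q ≠ 0) (n : ℕ) {a : ℕ} (ha : a ≤ 7) :
    (q ^ 7) ^ (n + 1) * (q ^ a)⁻¹ = q ^ (7 - a + 7 * n) := by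
  rw [mul_inv_eq_iff_eq_mul₀ (pow_ne_zero a hq), ← pow_mul, ← pow_add]
  congr 1
  omega

section Multiples

variable (τ : ℍ) {a : ℕ}

theorem exp_mul_tau_conditions (ha : 0 < a) (ha' : a < 7) :
    Complex.exp (2 * Real.pi * Complex.I * (a * τ)) ≠ 1 ∧
    (∀ n : ℕ, 1 - Complex.exp (2 * Real.pi * Complex.I * (7 * τ)) ^ (n + 1) *
      Complex.exp (2 * Real.pi * Complex.I * (a * τ)) ≠ 0) ∧
    (∀ n : ℕ, 1 - Complex.exp (2 * Real.pi * Complex.I * (7 * τ)) ^ (n + 1) *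
      (Complex.exp (2 * Real.pi * Complex.I * (a * τ)))⁻¹ ≠ 0) := by
  have hq : ‖Complex.exp (2 * Real.pi * Complex.I * τ)‖ < 1 := norm_exp_two_pi_I_lt_one τ
  rw [exp_seven_mul, exp_nat_mul_tau]
  refine ⟨pow_ne_one_of_norm_lt hq ha.ne', fun n ↦ ?_, fun n ↦ ?_⟩
  · rw [pow_seven_mul_pow, sub_ne_zero]
    exact (pow_ne_one_of_norm_lt hq (by omega)).symm
  · rw [pow_seven_mul_inv_pow (Complex.exp_ne_zero _) n ha'.le, sub_ne_zero]
    exact (pow_ne_one_of_norm_lt hq (by omega)).symm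

theorem oddTheta_mul_tau_ne_zero (ha : 0 < a) (ha' : a < 7) :
    oddTheta (a * τ) (7 * τ) ≠ 0 := by
  obtain ⟨h0, h1, h2⟩ := exp_mul_tau_conditions τ ha ha'
  exact oddTheta_ne_zero (seven_mul_im_pos τ) h0 h1 h2

/-- With period 7τ and w = q^a the Euler factors involve exponents congruent to a and -a mod 7. The
term 1/(w - 1) supplies the missing first term of the class of a and turns the constant 1/2 into
-1/2. -/
theorem logDeriv_oddTheta_mul_tau (ha : 0 < a) (ha' : a < 7) :
    logDeriv (fun z ↦ oddTheta z (7 * τ)) (a * τ) = 2 * Real.pi * Complex.I *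
      (-(1 / 2) - lambertClass (Complex.exp (2 * Real.pi * Complex.I * τ)) a +
        lambertClass (Complex.exp (2 * Real.pi * Complex.I * τ)) (7 - a)) := by
  obtain ⟨h0, h1, h2⟩ := exp_mul_tau_conditions τ ha ha'
  have hq : ‖Complex.exp (2 * Real.pi * Complex.I * τ)‖ < 1 := norm_exp_two_pi_I_lt_one τ
  rw [logDeriv_oddTheta (seven_mul_im_pos τ) h0 h1 h2, exp_seven_mul, exp_nat_mul_tau]
  rw [exp_nat_mul_tau] at h0
  simp_rw [pow_seven_mul_pow, pow_seven_mul_inv_pow (Complex.exp_ne_zero _) _ ha'.le]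
  set q := Complex.exp (2 * Real.pi * Complex.I * τ)
  have hs : Summable fun m : ℕ ↦ q ^ (a + 7 * m) / (1 - q ^ (a + 7 * m)) :=
    (summable_lambert_nat hq).comp_injective (i := fun m ↦ a + 7 * m)
      (fun m n h ↦ by simpa using h)
  have hl : lambertClass q a = q ^ a / (1 - q ^ a) +
      ∑' m : ℕ, q ^ (a + 7 * (m + 1)) / (1 - q ^ (a + 7 * (m + 1))) := by
    rw [lambertClass, hs.tsum_eq_zero_add]
    simp
  rw [hl, lambertClass]
  have e1 : q ^ a - 1 ≠ 0 := sub_ne_zero.mpr h0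
  have e2 : 1 / (q ^ a - 1) = -1 - q ^ a / (1 - q ^ a) := by
    rw [← neg_sub (q ^ a) 1, div_neg]
    field_simp
    ring
  rw [e2]
  ring

end Multiples

/-! ### The Eisenstein sum and its diamond translates as theta quotients. -/

theorem eisensteinSum_eq_thetaQuot (τ : ℍ) :
    -(2 * Real.pi * Complex.I) * eisensteinSum 7 τ = thetaQuot τ (7 * τ) := by
  have hq : ‖Complex.exp (2 * Real.pi * Complex.I * τ)‖ < 1 := norm_exp_two_pi_I_lt_one τ
  have n1 := oddTheta_mul_tau_ne_zero τ (a := 1) (by norm_num) (by norm_num)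
  have n2 := oddTheta_mul_tau_ne_zero τ (a := 2) (by norm_num) (by norm_num)
  have n4 := oddTheta_mul_tau_ne_zero τ (a := 4) (by norm_num) (by norm_num)
  have l1 := logDeriv_oddTheta_mul_tau τ (a := 1) (by norm_num) (by norm_num)
  have l2 := logDeriv_oddTheta_mul_tau τ (a := 2) (by norm_num) (by norm_num)
  have l4 := logDeriv_oddTheta_mul_tau τ (a := 4) (by norm_num) (by norm_num)
  simp only [Nat.cast_one, one_mul, Nat.cast_ofNat, Nat.reduceSub] at n1 n2 n4 l1 l2 l4
  -- With weights 2, 1, -1 at τ, 2τ, 4τ the constants add to -1, and the Lambert series reproduce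
  -- minus the coefficients 2, 1, 1, -1, -1, -2.
  rw [← logDeriv_add_eq_thetaQuot (seven_mul_im_pos τ) n1 n2 n4, l1, l2, l4, eisensteinSum_seven,
    tsum_levelCoeff hq]
  ring

theorem diamond_eisensteinSum (γ : Gamma0 7) (τ : ℍ) :
    -(2 * Real.pi * Complex.I) * diamond 1 γ (eisensteinSum 7) τ =
      thetaQuot (((γ : SL(2, ℤ)) 0 0 : ℤ) * τ) (7 * τ) := by
  obtain ⟨g, hg⟩ := γ
  obtain ⟨c, hc⟩ : (7 : ℤ) ∣ g 1 0 :=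
    (ZMod.intCast_zmod_eq_zero_iff_dvd (g 1 0) 7).mp (Gamma0_mem.mp hg)
  have hdet : g 0 0 * g 1 1 - g 0 1 * g 1 0 = 1 := by
    rw [← Matrix.det_fin_two]; exact g.2
  -- The conjugate of γ by diag(7, 1): it is integral because 7 divides the lower left entry, and it
  -- sends 7τ to 7γτ with the same denominator.
  set h : SL(2, ℤ) := ⟨!![g 0 0, 7 * g 0 1; c, g 1 1], by
    rw [Matrix.det_fin_two_of]; linear_combination hdet + g 0 1 * hc⟩ with hh
  set σ : ℍ := ⟨7 * (τ : ℂ), seven_mul_im_pos τ⟩ with hσ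
  have hσc : (σ : ℂ) = 7 * τ := rfl
  have hcC : (g 1 0 : ℂ) = 7 * c := mod_cast congrArg (Int.cast (R := ℂ)) hc
  have hd := specialLinear_denom_ne_zero g τ
  have key := thetaQuot_modular h ((g 0 0 : ℂ) * τ + g 0 1) σ
  have e00 : h 0 0 = g 0 0 := rfl
  have e01 : h 0 1 = 7 * g 0 1 := rfl
  have e10 : h 1 0 = c := rfl
  have e11 : h 1 1 = g 1 1 := rfl
  have ed : (h 1 0 : ℂ) * σ + h 1 1 = g 1 0 * τ + g 1 1 := by
    rw [e10, e11, hσc, hcC]; ring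
  have ec : ((h • σ : ℍ) : ℂ) = 7 * (g • τ : ℍ) := by
    rw [specialLinear_smul_coe, ed, specialLinear_smul_coe, e00, e01, hσc]
    push_cast
    ring
  rw [ed, ec, ← specialLinear_smul_coe, ← eisensteinSum_eq_thetaQuot, hσc,
    thetaQuot_add_int] at key
  rw [diamond_apply, zpow_neg_one, mul_left_comm, key, ← mul_assoc, inv_mul_cancel₀ hd, one_mul]

theorem thetaQuot_tau_congr (τ : ℂ) {a b : ℤ} (hab : (a : ZMod 7) = b) :
    thetaQuot (a * τ) (7 * τ) = thetaQuot (b * τ) (7 * τ) := by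
  obtain ⟨k, hk⟩ := (ZMod.intCast_eq_intCast_iff_dvd_sub b a 7).mp hab.symm
  have : (a : ℂ) * τ = b * τ + k * (7 * τ) := by
    rw [eq_add_of_sub_eq hk]; push_cast; ring
  rw [this, thetaQuot_add_int_mul]

theorem Gamma0_seven_upper_left (γ : Gamma0 7) :
    ((γ : SL(2, ℤ)) 0 0 : ZMod 7) * Gamma0Map 7 γ = 1 := by
  obtain ⟨g, hg⟩ := γ
  have hdet : g 0 0 * g 1 1 - g 0 1 * g 1 0 = 1 := by
    rw [← Matrix.det_fin_two]; exact g.2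
  have h := congrArg (Int.cast (R := ZMod 7)) hdet
  push_cast at h
  rw [Gamma0_mem.mp hg, mul_zero, sub_zero] at h
  exact h

/-! ### Theta constants of order seven -/

/-- Expanding the square, the part of the exponent linear in n is (l - 1/2)τ = (l - 4)τ + 7τ/2, and
7τ/2 is the half period built into `oddTheta`; the normalization removes the remaining constant
phase. -/
theorem normThetaConst_seven (l : ℕ) (τ : ℂ) :
    normThetaConst 7 l τ =
      Complex.exp (Real.pi * Complex.I * τ * ((2 * l - 1) ^ 2 / 28 - (l - 4))) *
        oddTheta ((l - 4) * τ) (7 * τ) := by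
  rw [normThetaConst, thetaConst, thetaChar, oddTheta, jacobiTheta₂, ← tsum_mul_left,
    ← tsum_mul_left, ← tsum_mul_left]
  refine tsum_congr fun n ↦ ?_
  rw [jacobiTheta₂_term, ← Complex.exp_add, ← Complex.exp_add, ← Complex.exp_add]
  congr 1
  push_cast
  ring

theorem differentiableAt_normThetaConst_seven (l : ℕ) {τ : ℂ} (hτ : 0 < τ.im) :
    DifferentiableAt ℂ (normThetaConst 7 l) τ := by
  have h7 : 0 < (7 * τ).im := by simpa using hτ
  have hJ : DifferentiableAt ℂ
      (fun τ : ℂ ↦ jacobiTheta₂ ((l - 4) * τ + (1 + 7 * τ) / 2) (7 * τ)) τ :=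
    DifferentiableAt.comp τ (f := fun τ : ℂ ↦ ((l - 4) * τ + (1 + 7 * τ) / 2, 7 * τ))
      (hasFDerivAt_jacobiTheta₂ ((l - 4) * τ + (1 + 7 * τ) / 2) h7).differentiableAt (by fun_prop)
  rw [funext (normThetaConst_seven l)]
  refine DifferentiableAt.mul (by fun_prop) (DifferentiableAt.mul (by fun_prop) hJ)

/-- The local parameter `exp(πiτ/28)`. -/
def thetaNome (τ : ℂ) : ℂ := Complex.exp (Real.pi * Complex.I * τ / 28)

theorem thetaNome_ne_zero (τ : ℂ) : thetaNome τ ≠ 0 := Complex.exp_ne_zero _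

theorem thetaNome_pow (τ : ℂ) (n : ℕ) :
    thetaNome τ ^ n = Complex.exp (Real.pi * Complex.I * τ * n / 28) := by
  rw [thetaNome, ← Complex.exp_nat_mul]; congr 1; ring

theorem normThetaConst_seven_one (τ : ℂ) :
    normThetaConst 7 1 τ = -(thetaNome τ ^ 85 * oddTheta (3 * τ) (7 * τ)) := by
  rw [normThetaConst_seven, thetaNome_pow, ← mul_neg, ← oddTheta_neg]
  congr 2 <;> push_cast <;> ring

theorem normThetaConst_seven_two (τ : ℂ) :
    normThetaConst 7 2 τ = -(thetaNome τ ^ 65 * oddTheta (2 * τ) (7 * τ)) := by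
  rw [normThetaConst_seven, thetaNome_pow, ← mul_neg, ← oddTheta_neg]
  congr 2 <;> push_cast <;> ring

theorem normThetaConst_seven_three (τ : ℂ) :
    normThetaConst 7 3 τ = -(thetaNome τ ^ 53 * oddTheta τ (7 * τ)) := by
  rw [normThetaConst_seven, thetaNome_pow, ← mul_neg, ← oddTheta_neg]
  congr 2 <;> push_cast <;> ring

theorem oddTheta_tau_ne_zero (τ : ℍ) : oddTheta τ (7 * τ) ≠ 0 := by
  simpa using oddTheta_mul_tau_ne_zero τ (a := 1) (by norm_num) (by norm_num)

theorem oddTheta_two_tau_ne_zero (τ : ℍ) : oddTheta (2 * τ) (7 * τ) ≠ 0 := by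
  simpa using oddTheta_mul_tau_ne_zero τ (a := 2) (by norm_num) (by norm_num)

theorem oddTheta_three_tau_ne_zero (τ : ℍ) : oddTheta (3 * τ) (7 * τ) ≠ 0 := by
  simpa using oddTheta_mul_tau_ne_zero τ (a := 3) (by norm_num) (by norm_num)

theorem normThetaConst_seven_ne_zero {l : ℕ} (hl : l ∈ ({1, 2, 3} : Set ℕ)) (τ : ℍ) :
    normThetaConst 7 l τ ≠ 0 := by
  have hy := thetaNome_ne_zero τ
  rcases hl with rfl | rfl | rfl
  · rw [normThetaConst_seven_one]
    exact neg_ne_zero.mpr (mul_ne_zero (pow_ne_zero _ hy) (oddTheta_three_tau_ne_zero τ))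
  · rw [normThetaConst_seven_two]
    exact neg_ne_zero.mpr (mul_ne_zero (pow_ne_zero _ hy) (oddTheta_two_tau_ne_zero τ))
  · rw [normThetaConst_seven_three]
    exact neg_ne_zero.mpr (mul_ne_zero (pow_ne_zero _ hy) (oddTheta_tau_ne_zero τ))

theorem eta_seven_pow_three (τ : ℂ) :
    ModularForm.eta (7 * τ) ^ 3 =
      thetaNome τ ^ 49 * eulerProd (Complex.exp (2 * Real.pi * Complex.I * (7 * τ))) 1 ^ 3 := by
  rw [ModularForm.eta, mul_pow, thetaNome_pow, Function.Periodic.qParam, ← Complex.exp_nat_mul]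
  congr 2
  · push_cast
    ring
  · rw [eulerProd]
    refine tprod_congr fun n ↦ ?_
    rw [ModularForm.eta_q_eq_pow, mul_one]

/-- Reduction of `θ(mτ)` modulo the period `7τ`. -/
theorem oddTheta_reduce (τ : ℂ) (m n : ℤ) (k : ℕ) (hk : n * (2 * m + 7 * n) = k) :
    thetaNome τ ^ (28 * k) * oddTheta ((m + 7 * n : ℤ) * τ) (7 * τ) =
      (-1) ^ n * oddTheta (m * τ) (7 * τ) := by
  have hk' : (n : ℂ) * (2 * m + 7 * n) = k := mod_cast congrArg (Int.cast (R := ℂ)) hk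
  have : ((m + 7 * n : ℤ) : ℂ) * τ = m * τ + n * (7 * τ) := by push_cast; ring
  rw [this, oddTheta_add_int_mul, thetaNome_pow, ← mul_assoc, mul_left_comm, ← Complex.exp_add]
  have e : Real.pi * Complex.I * τ * ((28 * k : ℕ) : ℂ) / 28 +
      -(Real.pi * Complex.I * (n ^ 2 * (7 * τ) + 2 * n * (m * τ))) = 0 := by
    push_cast
    linear_combination (-(Real.pi * Complex.I * τ)) * hk'
  rw [e, Complex.exp_zero, mul_one]

theorem oddTheta_four_tau (τ : ℂ) :
    thetaNome τ ^ 28 * oddTheta (4 * τ) (7 * τ) = oddTheta (3 * τ) (7 * τ) := by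
  have := oddTheta_reduce τ (-3) 1 1 (by norm_num)
  norm_num [oddTheta_neg] at this
  exact this

theorem oddTheta_five_tau (τ : ℂ) :
    thetaNome τ ^ 84 * oddTheta (5 * τ) (7 * τ) = oddTheta (2 * τ) (7 * τ) := by
  have := oddTheta_reduce τ (-2) 1 3 (by norm_num)
  norm_num [oddTheta_neg] at this
  exact this

theorem oddTheta_six_tau (τ : ℂ) :
    thetaNome τ ^ 140 * oddTheta (6 * τ) (7 * τ) = oddTheta τ (7 * τ) := by
  have := oddTheta_reduce τ (-1) 1 5 (by norm_num)
  norm_num [oddTheta_neg] at this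
  exact this

theorem oddTheta_eight_tau (τ : ℂ) :
    thetaNome τ ^ 252 * oddTheta (8 * τ) (7 * τ) = -oddTheta τ (7 * τ) := by
  have := oddTheta_reduce τ 1 1 9 (by norm_num)
  norm_num at this
  exact this

theorem oddTheta_twelve_tau (τ : ℂ) :
    thetaNome τ ^ 560 * oddTheta (12 * τ) (7 * τ) = -oddTheta (2 * τ) (7 * τ) := by
  have := oddTheta_reduce τ (-2) 2 20 (by norm_num)
  norm_num [oddTheta_neg] at this
  exact this

theorem oddTheta_sixteen_tau (τ : ℂ) :
    thetaNome τ ^ 1008 * oddTheta (16 * τ) (7 * τ) = oddTheta (2 * τ) (7 * τ) := by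
  have := oddTheta_reduce τ 2 2 36 (by norm_num)
  norm_num at this
  exact this

section Quotients

variable (τ : ℍ)

/-- Reducing θ(4τ) to θ(3τ) leaves θ'(0)θ(3τ)/θ(τ)² times the 28th power of the nome, and 28 = 49 +
85 - 2·53 matches the exponents of η³, φ₁ and φ₃². -/
theorem thetaQuot_tau : thetaQuot τ (7 * τ) = -(2 * Real.pi * Complex.I) *
    (ModularForm.eta (7 * τ) ^ 3 * (normThetaConst 7 1 τ / normThetaConst 7 3 τ ^ 2)) := by
  have h4 := oddTheta_four_tau τ
  have hy := thetaNome_ne_zero τ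
  have n1 := oddTheta_tau_ne_zero τ
  have n3 := oddTheta_three_tau_ne_zero τ
  rw [thetaQuot, deriv_oddTheta_zero (seven_mul_im_pos τ), eta_seven_pow_three,
    normThetaConst_seven_one, normThetaConst_seven_three,
    eq_div_of_mul_eq (pow_ne_zero 28 hy) ((mul_comm _ _).trans h4)]
  generalize thetaNome τ = y at *
  field_simp

theorem thetaQuot_four_tau : thetaQuot (4 * τ) (7 * τ) = -(2 * Real.pi * Complex.I) *
    (ModularForm.eta (7 * τ) ^ 3 * (normThetaConst 7 2 τ / normThetaConst 7 1 τ ^ 2)) := by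
  have hy := thetaNome_ne_zero τ
  have n2 := oddTheta_two_tau_ne_zero τ
  have n3 := oddTheta_three_tau_ne_zero τ
  rw [thetaQuot, deriv_oddTheta_zero (seven_mul_im_pos τ), eta_seven_pow_three,
    normThetaConst_seven_one, normThetaConst_seven_two,
    show (3 : ℂ) * (4 * τ) = 12 * τ by ring, show (4 : ℂ) * (4 * τ) = 16 * τ by ring,
    eq_div_of_mul_eq (pow_ne_zero 28 hy) ((mul_comm _ _).trans (oddTheta_four_tau τ)),
    eq_div_of_mul_eq (pow_ne_zero 560 hy) ((mul_comm _ _).trans (oddTheta_twelve_tau τ)),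
    eq_div_of_mul_eq (pow_ne_zero 1008 hy) ((mul_comm _ _).trans (oddTheta_sixteen_tau τ))]
  generalize thetaNome τ = y at *
  field_simp

theorem thetaQuot_two_tau : thetaQuot (2 * τ) (7 * τ) = -(2 * Real.pi * Complex.I) *
    -(ModularForm.eta (7 * τ) ^ 3 * (normThetaConst 7 3 τ / normThetaConst 7 2 τ ^ 2)) := by
  have hy := thetaNome_ne_zero τ
  have n1 := oddTheta_tau_ne_zero τ
  have n2 := oddTheta_two_tau_ne_zero τ
  rw [thetaQuot, deriv_oddTheta_zero (seven_mul_im_pos τ), eta_seven_pow_three,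
    normThetaConst_seven_three, normThetaConst_seven_two,
    show (3 : ℂ) * (2 * τ) = 6 * τ by ring, show (4 : ℂ) * (2 * τ) = 8 * τ by ring,
    eq_div_of_mul_eq (pow_ne_zero 140 hy) ((mul_comm _ _).trans (oddTheta_six_tau τ)),
    eq_div_of_mul_eq (pow_ne_zero 252 hy) ((mul_comm _ _).trans (oddTheta_eight_tau τ))]
  generalize thetaNome τ = y at *
  field_simp

theorem kleinForm_thetaVector : kleinForm (thetaVector τ) = 0 := by
  have h := oddTheta_three_term (seven_mul_im_pos τ) (3 * τ) (2 * τ) τ 0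
  have hy := thetaNome_ne_zero τ
  rw [show (3 : ℂ) * τ + 2 * τ = 5 * τ by ring, show (3 : ℂ) * τ - 2 * τ = τ by ring,
    show (3 : ℂ) * τ + τ = 4 * τ by ring, show (3 : ℂ) * τ - τ = 2 * τ by ring,
    show (2 : ℂ) * τ + τ = 3 * τ by ring, show (2 : ℂ) * τ - τ = τ by ring] at h
  simp only [add_zero, sub_zero] at h
  have h4 := oddTheta_four_tau τ
  have h5 := oddTheta_five_tau τ
  have : kleinForm (thetaVector τ) = normThetaConst 7 2 τ ^ 3 * normThetaConst 7 1 τ +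
      normThetaConst 7 1 τ ^ 3 * -normThetaConst 7 3 τ +
      (-normThetaConst 7 3 τ) ^ 3 * normThetaConst 7 2 τ := rfl
  rw [this, normThetaConst_seven_one, normThetaConst_seven_two, normThetaConst_seven_three]
  -- The monomials of the quartic carry nome exponents 280, 308 and 224; the reductions of θ(4τ) and
  -- θ(5τ) supply 28 and 84, bringing all three to 308.
  linear_combination (-(thetaNome τ ^ 308)) * h -
    thetaNome τ ^ 280 * oddTheta (2 * τ) (7 * τ) ^ 3 * h4 +
    thetaNome τ ^ 224 * oddTheta τ (7 * τ) ^ 3 * h5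

end Quotients

/-! ### Non-constancy of the map to the Klein quartic. -/

theorem thetaNome_add_one (τ : ℂ) :
    thetaNome (τ + 1) = thetaNome τ * Complex.exp (Real.pi * Complex.I / 28) := by
  rw [thetaNome, thetaNome, ← Complex.exp_add]; congr 1; ring

theorem oddTheta_seven_translate (τ : ℂ) (n : ℕ) :
    oddTheta (n * (τ + 1)) (7 * (τ + 1)) = (-1) ^ n * oddTheta (n * τ) (7 * τ) := by
  have h (z σ : ℂ) : oddTheta z (σ + 7) = oddTheta z σ := by
    rw [show σ + 7 = σ + 1 + 1 + 1 + 1 + 1 + 1 + 1 by ring]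
    simp only [oddTheta_add_one_right]
  have e : (n : ℂ) * (τ + 1) = n * τ + (n : ℤ) := by push_cast; ring
  rw [mul_add 7 τ 1, mul_one, h, e, oddTheta_add_int, zpow_natCast]

theorem thetaVector_ne_zero (τ : ℍ) : thetaVector τ ≠ 0 := fun h ↦
  normThetaConst_seven_ne_zero (l := 2) (by simp) τ (congrFun h 0)

/-- Under τ ↦ τ + 1 the first two coordinates are multiplied by ζ^65 and -ζ^85, with ζ = exp(πi/28).
Equality of the projective points would force ζ^20 = -1, that is 20 ≡ 28 mod 56. -/
theorem mk_thetaVector_translate_ne (τ : ℍ) :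
    Projectivization.mk ℂ (thetaVector ((1 : ℝ) +ᵥ τ)) (thetaVector_ne_zero _) ≠
      Projectivization.mk ℂ (thetaVector τ) (thetaVector_ne_zero τ) := by
  rw [ne_eq, Projectivization.mk_eq_mk_iff']
  rintro ⟨t, ht⟩
  have h0 : t * normThetaConst 7 2 τ = normThetaConst 7 2 ((1 : ℝ) +ᵥ τ : ℍ) := congrFun ht 0
  have h1 : t * normThetaConst 7 1 τ = normThetaConst 7 1 ((1 : ℝ) +ᵥ τ : ℍ) := congrFun ht 1
  have hc : (((1 : ℝ) +ᵥ τ : ℍ) : ℂ) = τ + 1 := by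
    rw [UpperHalfPlane.coe_vadd, add_comm]; simp
  have hy := thetaNome_ne_zero τ
  have t2 := oddTheta_seven_translate τ 2
  have t3 := oddTheta_seven_translate τ 3
  norm_num at t2 t3
  rw [hc, normThetaConst_seven_two, normThetaConst_seven_two, thetaNome_add_one, t2] at h0
  rw [hc, normThetaConst_seven_one, normThetaConst_seven_one, thetaNome_add_one, t3] at h1
  set ζ := Complex.exp (Real.pi * Complex.I / 28) with hζ
  have e0 : t = ζ ^ 65 := by
    refine mul_right_cancel₀ (mul_ne_zero (pow_ne_zero 65 hy) (oddTheta_two_tau_ne_zero τ)) ?_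
    linear_combination -h0
  have e1 : t = -ζ ^ 85 := by
    refine mul_right_cancel₀ (mul_ne_zero (pow_ne_zero 85 hy) (oddTheta_three_tau_ne_zero τ)) ?_
    linear_combination -h1
  have hζ0 : ζ ≠ 0 := Complex.exp_ne_zero _
  have e2 : ζ ^ 20 = -1 := by
    refine mul_left_cancel₀ (pow_ne_zero 65 hζ0) ?_
    linear_combination e1 - e0
  rw [hζ, ← Complex.exp_nat_mul, ← Complex.exp_pi_mul_I, Complex.exp_eq_exp_iff_exists_int] at e2
  obtain ⟨k, hk⟩ := e2
  have hpi : (Real.pi : ℂ) * Complex.I ≠ 0 :=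
    mul_ne_zero (by exact_mod_cast Real.pi_ne_zero) Complex.I_ne_zero
  have : (20 : ℂ) = 28 + 56 * k := by
    refine mul_left_cancel₀ hpi ?_
    push_cast at hk
    linear_combination 28 * hk
  have : (20 : ℤ) = 28 + 56 * k := by exact_mod_cast this
  omega

end KleinTheta

end

/-! ### Assembly of the main theorem. -/

theorem mainTheorem10 :
    (∀ γ₁ γ₂ γ₄ : CongruenceSubgroup.Gamma0 7,
      CongruenceSubgroup.Gamma0Map 7 γ₁ = 1 →
      CongruenceSubgroup.Gamma0Map 7 γ₂ = 2 →
      CongruenceSubgroup.Gamma0Map 7 γ₄ = 4 →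
      ∀ τ : UpperHalfPlane,
        let E₁ := KleinTheta.diamond 1 γ₁ (KleinTheta.eisensteinSum 7) τ
        let E₂ := KleinTheta.diamond 1 γ₂ (KleinTheta.eisensteinSum 7) τ
        let E₄ := KleinTheta.diamond 1 γ₄ (KleinTheta.eisensteinSum 7) τ
        let φ₁ := KleinTheta.normThetaConst 7 1 τ
        let φ₂ := KleinTheta.normThetaConst 7 2 τ
        let φ₃ := KleinTheta.normThetaConst 7 3 τ
        E₂ * E₄ + E₂ * E₁ + E₄ * E₁ = 0 ∧
        E₁ = ModularForm.eta (7 * τ) ^ 3 * (φ₁ / φ₃ ^ 2) ∧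
        E₂ = ModularForm.eta (7 * τ) ^ 3 * (φ₂ / φ₁ ^ 2) ∧
        E₄ = -(ModularForm.eta (7 * τ) ^ 3 * (φ₃ / φ₂ ^ 2))) ∧
    (∀ l ∈ ({1, 2, 3} : Set ℕ),
      DifferentiableOn ℂ (KleinTheta.normThetaConst 7 l) {τ : ℂ | 0 < τ.im} ∧
      ∀ τ : UpperHalfPlane, KleinTheta.normThetaConst 7 l τ ≠ 0) ∧
    ∃ h : ∀ τ : UpperHalfPlane, KleinTheta.thetaVector τ ≠ 0,
      (∀ τ : UpperHalfPlane,
        Projectivization.mk ℂ (KleinTheta.thetaVector τ) (h τ) ∈ KleinTheta.kleinQuartic) ∧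
      ∃ τ τ' : UpperHalfPlane,
        Projectivization.mk ℂ (KleinTheta.thetaVector τ) (h τ) ≠
          Projectivization.mk ℂ (KleinTheta.thetaVector τ') (h τ') := by
  have hpi : -(2 * Real.pi * Complex.I) ≠ 0 := by
    simp [Real.pi_ne_zero]
  refine ⟨fun γ₁ γ₂ γ₄ h₁ h₂ h₄ τ ↦ ?_, fun l hl ↦ ⟨fun τ hτ ↦
    (KleinTheta.differentiableAt_normThetaConst_seven l hτ).differentiableWithinAt,
    KleinTheta.normThetaConst_seven_ne_zero hl⟩, KleinTheta.thetaVector_ne_zero, fun τ ↦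
    (KleinTheta.mk_mem_kleinQuartic _ _).mpr (KleinTheta.kleinForm_thetaVector τ),
    _, _, KleinTheta.mk_thetaVector_translate_ne UpperHalfPlane.I⟩
  have main (γ : CongruenceSubgroup.Gamma0 7) (a d : ℕ) (had : ∀ x : ZMod 7, x * d = 1 → x = a)
      (hγ : CongruenceSubgroup.Gamma0Map 7 γ = d) :
      -(2 * Real.pi * Complex.I) * KleinTheta.diamond 1 γ (KleinTheta.eisensteinSum 7) τ =
        KleinTheta.thetaQuot (a * τ) (7 * τ) := by
    have hu := KleinTheta.Gamma0_seven_upper_left γ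
    rw [hγ] at hu
    rw [KleinTheta.diamond_eisensteinSum,
      KleinTheta.thetaQuot_tau_congr τ (b := a) (by simpa using had _ hu)]
    simp
  -- The multiplier of τ is the upper left entry, the inverse of d mod 7: hence d = 1, 2, 4 give 1,
  -- 4, 2.
  have m1 := main γ₁ 1 1 (by decide) (by simpa using h₁)
  have m2 := main γ₂ 4 2 (by decide) (by simpa using h₂)
  have m4 := main γ₄ 2 4 (by decide) (by simpa using h₄)
  rw [Nat.cast_one, one_mul, KleinTheta.thetaQuot_tau] at m1
  rw [Nat.cast_ofNat, KleinTheta.thetaQuot_four_tau] at m2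
  rw [Nat.cast_ofNat, KleinTheta.thetaQuot_two_tau] at m4
  have e1 := mul_left_cancel₀ hpi m1
  have e2 := mul_left_cancel₀ hpi m2
  have e4 := mul_left_cancel₀ hpi m4
  refine ⟨?_, e1, e2, e4⟩
  have hk : KleinTheta.normThetaConst 7 2 τ ^ 3 * KleinTheta.normThetaConst 7 1 τ +
      KleinTheta.normThetaConst 7 1 τ ^ 3 * -KleinTheta.normThetaConst 7 3 τ +
      (-KleinTheta.normThetaConst 7 3 τ) ^ 3 * KleinTheta.normThetaConst 7 2 τ = 0 :=
    KleinTheta.kleinForm_thetaVector τ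
  have n1 := KleinTheta.normThetaConst_seven_ne_zero (l := 1) (by simp) τ
  have n2 := KleinTheta.normThetaConst_seven_ne_zero (l := 2) (by simp) τ
  have n3 := KleinTheta.normThetaConst_seven_ne_zero (l := 3) (by simp) τ
  rw [e1, e2, e4]
  field_simp
  -- After clearing the denominators, the sum of the three products is η(7τ)^6 times the quartic
  -- form.
  linear_combination ModularForm.eta (7 * τ) ^ 6 * hk
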